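/- Let $f\in L^2(0,1)$ and let $u\in H^3(0,1)$ be the solution of $-u''=f$ in $(0,1)$, $u(0)=u(1)=0$. Let $\eta\in(-\tfrac32,5)$. For an integer $N\ge 2$ put $h=1/N$, $x_i=ih$, and let $\mathcal T_h$ consist of the cells $K_j=[x_j,x_{j+1}]$, $0\le j<N$. Let $V_h^0$ be the space of functions that are constant on each cell. For $v\in V_h^0$ let $R^2v$ be the piecewise polynomial whose restriction to $K_j$ is the polynomial $p_j$ of degree at most $2$ with $\int_{K'}p_j\,dx=\int_{K'}v\,dx$ for each $K'\in\{K_{j-1},K_j,K_{j+1}\}\cap\mathcal T_h$, where in addition $p_0(0)=0$ on the first cell and $p_{N-1}(1)=0$ on the last cell (this replaces the condition on the missing neighbour). The reduced discontinuous Galerkin space is $U_h^2=R^2V_h^0$. At an interior node $x_i$ let $[\![w]\!]=w(x_i^-)-w(x_i^+)$, $\{w\}=\tfrac12(w(x_i^-)+w(x_i^+))$ and $n=1$; at a boundary node let $[\![w]\!]=\{w\}$ be the trace of $w$ from inside and let $n$ be the outward normal ($n=-1$ at $0$, $n=1$ at $1$). With derivatives taken cell by cell, put $$a_h(w,v)=\sum_{K\in\mathcal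 T_h}\int_K w'v'\,dx-\sum_{i=0}^N\big(\{w'\}\,n\,[\![v]\!]\big)(x_i)-\sum_{i=0}^N\big([\![w]\!]\,\{v'\}\,n\big)(x_i)+\sum_{i=0}^N\frac{\eta}{h}\big([\![w]\!]\,[\![v]\!]\big)(x_i),$$ $$\|w\|_{\mathrm{sip},*}^2=\sum_{K\in\mathcal T_h}\|w'\|_{L^2(K)}^2+\sum_{i=0}^N\frac1h[\![w]\!](x_i)^2+\sum_{K\in\mathcal T_h}h\sum_{x\in\partial K}\big|w'|_K(x)\big|^2 .$$ Then there are $h_0>0$ and $C>0$, independent of $h$, such that for all such $h<h_0$ there is exactly one $u_h\in U_h^2$ with $a_h(u_h,v_h)=\int_0^1 f v_h\,dx$ for all $v_h\in V_h^0$, and it satisfies $$\|u-u_h\|_{\mathrm{sip},*}\le Ch^2,\qquad \|u-u_h\|_{L^2(0,1)}\le Ch^2 .$$ -/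

import Mathlib

open MeasureTheory Set Polynomial
open scoped ContDiff

noncomputable section

namespace RDG

/-! ### Sobolev spaces on the unit interval and the Poisson problem -/

/-- `g'` is a weak derivative of `g` on the open interval `(0,1)`. -/
def HasWeakDeriv (g g' : ℝ → ℝ) : Prop :=
  ∀ φ : ℝ → ℝ, ContDiff ℝ ∞ φ → HasCompactSupport φ → tsupport φ ⊆ Ioo 0 1 →
    ∫ x in Ioo (0 : ℝ) 1, g x * deriv φ x = -∫ x in Ioo (0 : ℝ) 1, g' x * φ x

/-- `u ∈ L²(0,1)`. -/
def MemL2 (u : ℝ → ℝ) : Prop := MemLp u 2 (volume.restrict (Ioo (0 : ℝ) 1))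

/-- `u ∈ H^s(0,1)`: `u` and its weak derivatives up to order `s` are square integrable. -/
def MemSobolev : ℕ → (ℝ → ℝ) → Prop
  | 0, u => MemL2 u
  | s + 1, u => MemL2 u ∧ ∃ u' : ℝ → ℝ, HasWeakDeriv u u' ∧ MemSobolev s u'

/-- `u ∈ H²(0,1)` solves `-u'' = f` in `(0,1)`, `u(0) = u(1) = 0`.  A member of `H²(0,1)` has a
unique representative that is continuous on `[0,1]`; `u` stands for that representative, so that
its boundary traces are its values at `0` and `1`. -/
structure IsPoissonSolution (f u : ℝ → ℝ) : Prop where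
  memSobolev : MemSobolev 2 u
  continuousOn : ContinuousOn u (Icc 0 1)
  equation : ∃ u' : ℝ → ℝ, MemL2 u' ∧ HasWeakDeriv u u' ∧ HasWeakDeriv u' (fun x => -f x)
  left_eq_zero : u 0 = 0
  right_eq_zero : u 1 = 0

/-! ### The uniform mesh with `N` cells, and piecewise functions on it -/

/-- The mesh size `h = 1 / N`. -/
def meshSize (N : ℕ) : ℝ := 1 / (N : ℝ)

/-- The node `x_i = i h`. -/
def node (N i : ℕ) : ℝ := (i : ℝ) * meshSize N

/-- The closed cell `[x_j, x_{j+1}]`, `0 ≤ j < N`. -/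
def cell (N : ℕ) (j : Fin N) : Set ℝ := Icc (node N j) (node N (j + 1))

/-- A piecewise function: for each cell the function representing its restriction to that cell.
Only the values of `w j` on the `j`-th closed cell are used; the values at the two end points are
the traces from inside the cell. -/
abbrev Broken (N : ℕ) := Fin N → ℝ → ℝ

/-- The restriction of a globally defined function to the cells. -/
def restrictCells (N : ℕ) (u : ℝ → ℝ) : Broken N := fun _ => u

/-- The broken gradient, one-sided at the two end points of each cell. -/
def grad {N : ℕ} (w : Broken N) : Broken N := fun j => derivWithin (w j) (cell N j)

/-- The trace at the face `x_i` from the cell on its left (zero if there is none). -/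
def leftTrace {N : ℕ} (w : Broken N) (i : Fin (N + 1)) : ℝ :=
  if hi : 0 < i.val then w ⟨i.val - 1, by omega⟩ (node N i) else 0

/-- The trace at the face `x_i` from the cell on its right (zero if there is none). -/
def rightTrace {N : ℕ} (w : Broken N) (i : Fin (N + 1)) : ℝ :=
  if hi : i.val < N then w ⟨i.val, hi⟩ (node N i) else 0

/-- The unit normal of a face: from left to right at interior faces, outward at boundary faces. -/
def faceNormal {N : ℕ} (i : Fin (N + 1)) : ℝ := if i.val = 0 then -1 else 1

/-- The jump: left trace minus right trace at interior faces, the interior trace at boundary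
faces. -/
def jump {N : ℕ} (w : Broken N) (i : Fin (N + 1)) : ℝ :=
  if i.val = 0 then rightTrace w i
  else if i.val = N then leftTrace w i
  else leftTrace w i - rightTrace w i

/-- The average: mean of both traces at interior faces, the interior trace at boundary faces. -/
def avg {N : ℕ} (w : Broken N) (i : Fin (N + 1)) : ℝ :=
  if i.val = 0 then rightTrace w i
  else if i.val = N then leftTrace w i
  else (leftTrace w i + rightTrace w i) / 2

/-! ### Norms -/

/-- The norm of `L²(0,1)`, computed cell by cell. -/
def l2Norm {N : ℕ} (w : Broken N) : ℝ :=
  Real.sqrt (∑ j : Fin N, ∫ x in node N j..node N (j + 1), (w j x) ^ 2)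

/-- The square of the symmetric interior penalty norm. -/
def sipNormSq {N : ℕ} (w : Broken N) : ℝ :=
  (∑ j : Fin N, ∫ x in node N j..node N (j + 1), (grad w j x) ^ 2)
    + ∑ i : Fin (N + 1), 1 / meshSize N * (jump w i) ^ 2

/-- The extended norm `‖·‖_{sip,*}`: the square of the sip norm plus
`∑_K h_K ‖∇w|_K · n_K‖²_{L²(∂K)}`; in one dimension `∂K` consists of two points. -/
def sipStarNorm {N : ℕ} (w : Broken N) : ℝ :=
  Real.sqrt (sipNormSq w + ∑ j : Fin N, meshSize N *
    ((grad w j (node N j)) ^ 2 + (grad w j (node N (j + 1))) ^ 2))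

/-! ### Discrete spaces -/

/-- The space `V_h^k` of piecewise polynomials of degree at most `k`. -/
def dgSpace (N k : ℕ) : Set (Fin N → ℝ[X]) := {p | ∀ j, (p j).natDegree ≤ k}

/-- The piecewise function given by a family of polynomials. -/
def toBroken {N : ℕ} (p : Fin N → ℝ[X]) : Broken N := fun j x => (p j).eval x

/-- `p = R² w`: on each cell `p` is the quadratic polynomial that has the same integral as `w` over
every mesh cell of the three-cell stencil (the cell itself and its neighbours inside the domain);
on the first and on the last cell the value prescribed in the missing (virtual) neighbour is the
one that makes `p` vanish at the boundary point. -/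
structure IsReconstruction {N : ℕ} (w : Broken N) (p : Fin N → ℝ[X]) : Prop where
  natDegree_le : ∀ j, (p j).natDegree ≤ 2
  integral_eq : ∀ j j' : Fin N, j'.val ≤ j.val + 1 → j.val ≤ j'.val + 1 →
    ∫ x in node N j'..node N (j' + 1), (p j).eval x = ∫ x in node N j'..node N (j' + 1), w j' x
  left_eq_zero : ∀ j : Fin N, j.val = 0 → (p j).eval 0 = 0
  right_eq_zero : ∀ j : Fin N, j.val + 1 = N → (p j).eval 1 = 0

/-- The reduced discontinuous Galerkin space `U_h^2 = R² V_h^0`. -/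
def rdgSpace (N : ℕ) : Set (Fin N → ℝ[X]) :=
  {p | ∃ v ∈ dgSpace N 0, IsReconstruction (toBroken v) p}

/-! ### The scheme -/

/-- The symmetric interior penalty bilinear form with penalty parameter `η`. -/
def aSip (η : ℝ) {N : ℕ} (u v : Broken N) : ℝ :=
  (∑ j : Fin N, ∫ x in node N j..node N (j + 1), grad u j x * grad v j x)
    - (∑ i : Fin (N + 1), avg (grad u) i * faceNormal i * jump v i)
    - (∑ i : Fin (N + 1), jump u i * (avg (grad v) i * faceNormal i))
    + ∑ i : Fin (N + 1), η / meshSize N * (jump u i * jump v i)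

/-- The right-hand side `l(v) = ∑_K ∫_K f v`. -/
def load (f : ℝ → ℝ) {N : ℕ} (v : Broken N) : ℝ :=
  ∑ j : Fin N, ∫ x in node N j..node N (j + 1), f x * v j x

/-- `u_h ∈ U_h^2` and `a(u_h, v_h) = l(v_h)` for all `v_h ∈ V_h^0`. -/
def IsDiscreteSolution (η : ℝ) (f : ℝ → ℝ) (N : ℕ) (uh : Fin N → ℝ[X]) : Prop :=
  uh ∈ rdgSpace N ∧ ∀ vh ∈ dgSpace N 0, aSip η (toBroken uh) (toBroken vh) = load f (toBroken vh)

end RDG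

end

namespace RDG

/-! ### Weak derivatives on the unit interval -/

/-! For a quadratic, the difference of the averages over two adjacent cells of length `h` is exactly
`h` times the derivative at the common node. Hence neighbouring reconstructions have the same
derivative there. A member of the reduced space is thus described by its cell averages `a` and nodal
derivatives `d`, its broken gradient is the continuous piecewise linear interpolant of `d`, and its
jump at an interior node is `h/6` times the second difference of `d` (`mem_rdgSpace_iff`,
`leftTrace_sub_rightTrace_recPoly`).

Tested with piecewise constants, the scheme becomes a finite volume scheme with flux `-d i + η/6 *
δ²d i` (`isDiscreteSolution_iff`). Since `∫ f` over a cell is the difference of `-u'` at its ends,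
the error `e = d - u'` at the nodes satisfies `e - η/6 * δ²e = κ + η/6 * δ²u'` with `e = κ` at both
end nodes. As `-δ²` lies between `0` and `4`, this operator is coercive when `1 + 2η/3 > 0`, which
is `η > -3/2`. The constant `κ` is fixed by one quadrature condition on `d`, the discrete form of `∫
u' = u(1) - u(0) = 0`. This gives stability (`sum_sq_sub_le_of_flux`), and by linear algebra
existence and uniqueness.

For `u` in `H³`, `u''` has increments bounded by the square root of the step length times the
increment of `Γ = ∫ |u'''|²`. Summing over cells, the squares of the second differences of `u'` add
up to `O(h³)`, and the quadrature residual of `u'` is `O(h²)`. So `∑ e² = O(h³)`, and a weight `h`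
makes the squared energy error `O(h⁴)`. The `L²` bound follows from the broken Poincaré inequality,
without duality. -/

theorem integral_Ioo_eq_intervalIntegral (F : ℝ → ℝ) :
    ∫ x in Ioo (0 : ℝ) 1, F x = ∫ x in (0 : ℝ)..1, F x := by
  rw [intervalIntegral.integral_of_le zero_le_one, integral_Ioc_eq_integral_Ioo]

theorem MemL2.integrableOn {g : ℝ → ℝ} (hg : MemL2 g) : IntegrableOn g (Ioo 0 1) :=
  MemLp.integrable (by norm_num) hg

theorem integrableOn_mul_test {F φ : ℝ → ℝ} (hF : IntegrableOn F (Ioo 0 1)) (hφ : Continuous φ)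
    (hφc : HasCompactSupport φ) : IntegrableOn (fun x => F x * φ x) (Ioo 0 1) := by
  obtain ⟨K, hK⟩ := hφ.bounded_above_of_compact_support hφc
  exact Integrable.mul_bdd hF hφ.aestronglyMeasurable (Filter.Eventually.of_forall hK)

/-- A test function with zero mean has an antiderivative that is a test function. -/
theorem exists_test_antideriv {χ : ℝ → ℝ} (hχ : ContDiff ℝ ∞ χ) (hc : HasCompactSupport χ)
    (hs : tsupport χ ⊆ Ioo 0 1) (h0 : ∫ x in (0 : ℝ)..1, χ x = 0) :
    ∃ φ : ℝ → ℝ, ContDiff ℝ ∞ φ ∧ HasCompactSupport φ ∧ tsupport φ ⊆ Ioo 0 1 ∧ deriv φ = χ := by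
  have hcont : Continuous χ := hχ.continuous
  obtain ⟨a, b, ha, hb, hab⟩ : ∃ a b : ℝ, 0 < a ∧ b < 1 ∧ tsupport χ ⊆ Icc a b := by
    rcases (tsupport χ).eq_empty_or_nonempty with he | hne
    · exact ⟨1 / 2, 1 / 2, by norm_num, by norm_num, by simp [he]⟩
    · obtain ⟨a, haK, ha⟩ := IsCompact.exists_isLeast hc hne
      obtain ⟨b, hbK, hb⟩ := IsCompact.exists_isGreatest hc hne
      exact ⟨a, b, (hs haK).1, (hs hbK).2, fun x hx => ⟨ha hx, hb hx⟩⟩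
  have hz : ∀ x, x ∉ Icc a b → χ x = 0 := fun x hx =>
    image_eq_zero_of_notMem_tsupport fun h => hx (hab h)
  set φ : ℝ → ℝ := fun x => ∫ t in (0 : ℝ)..x, χ t with hφ
  have hd : ∀ x, HasDerivAt φ (χ x) x := fun x =>
    intervalIntegral.integral_hasDerivAt_right (hcont.intervalIntegrable _ _)
      (hcont.stronglyMeasurableAtFilter _ _) hcont.continuousAt
  have hderiv : deriv φ = χ := funext fun x => (hd x).deriv
  have hsupp : Function.support φ ⊆ Icc a b := by
    intro x hx
    by_contra hx'
    apply hx
    rcases lt_or_ge x a with h | h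
    · simp only [hφ]
      rw [intervalIntegral.integral_congr (g := fun _ => 0)]
      · simp
      · intro t ht
        refine hz t fun h' => ?_
        rw [mem_uIcc] at ht
        rcases ht with ht | ht <;> linarith [h'.1, ht.1, ht.2]
    · have hxb : b < x := by
        by_contra hcon
        exact hx' ⟨h, not_lt.1 hcon⟩
      -- Subtracting the vanishing total integral turns `φ x` into an integral between `1` and `x`,
      -- where `χ` is zero.
      have : φ x = φ x - ∫ t in (0 : ℝ)..1, χ t := by rw [h0]; ring
      rw [this]
      simp only [hφ]
      rw [intervalIntegral.integral_interval_sub_left (hcont.intervalIntegrable _ _)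
        (hcont.intervalIntegrable _ _), intervalIntegral.integral_congr (g := fun _ => 0)]
      · simp
      · intro t ht
        refine hz t fun h' => ?_
        rw [mem_uIcc] at ht
        rcases ht with ht | ht <;> linarith [h'.2, ht.1, ht.2]
  have hts : tsupport φ ⊆ Icc a b := closure_minimal hsupp isClosed_Icc
  refine ⟨φ, ?_, ?_, ?_, hderiv⟩
  · rw [contDiff_infty_iff_deriv, hderiv]
    exact ⟨fun x => (hd x).differentiableAt, hχ⟩
  · exact HasCompactSupport.of_support_subset_isCompact isCompact_Icc hsupp
  · exact hts.trans fun x hx => ⟨ha.trans_le hx.1, hx.2.trans_lt hb⟩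

/-- The lemma of du Bois-Reymond. -/
theorem exists_ae_eq_const {G : ℝ → ℝ} (hG : IntegrableOn G (Ioo 0 1))
    (h : ∀ φ : ℝ → ℝ, ContDiff ℝ ∞ φ → HasCompactSupport φ → tsupport φ ⊆ Ioo 0 1 →
      ∫ x in Ioo (0 : ℝ) 1, G x * deriv φ x = 0) :
    ∃ c : ℝ, ∀ᵐ x, x ∈ Ioo (0 : ℝ) 1 → G x = c := by
  -- A fixed test function of unit mass: subtracting its multiple `m * ψ₀` from any `χ` leaves a
  -- function of zero mean, hence a derivative of a test function. The constant is the pairing of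
  -- `G` with `ψ₀`.
  let B : ContDiffBump (1 / 2 : ℝ) := ⟨1 / 8, 1 / 4, by norm_num, by norm_num⟩
  set ψ₀ : ℝ → ℝ := B.normed volume with hψ₀
  have hψd : ContDiff ℝ ∞ ψ₀ := B.contDiff_normed
  have hψc : HasCompactSupport ψ₀ := B.hasCompactSupport_normed
  have hψs : tsupport ψ₀ ⊆ Ioo 0 1 := by
    rw [hψ₀, B.tsupport_normed_eq, Real.closedBall_eq_Icc]
    intro x hx
    simp only [B] at hx
    constructor <;> linarith [hx.1, hx.2]
  have hint : ∀ χ : ℝ → ℝ, tsupport χ ⊆ Ioo 0 1 → ∫ x in Ioo (0 : ℝ) 1, χ x = ∫ x, χ x :=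
    fun χ hχ => setIntegral_eq_integral_of_forall_compl_eq_zero fun x hx =>
      image_eq_zero_of_notMem_tsupport fun h' => hx (hχ h')
  have hψ1 : ∫ x in (0 : ℝ)..1, ψ₀ x = 1 := by
    rw [← integral_Ioo_eq_intervalIntegral, hint _ hψs]
    exact B.integral_normed
  set c : ℝ := ∫ x in Ioo (0 : ℝ) 1, G x * ψ₀ x with hc
  refine ⟨c, ?_⟩
  have key := isOpen_Ioo.ae_eq_zero_of_integral_contDiff_smul_eq_zero (μ := volume)
    (U := Ioo (0 : ℝ) 1) (f := fun x => G x - c) ?_ ?_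
  · filter_upwards [key] with x hx hx'
    exact sub_eq_zero.1 (hx hx')
  · exact (hG.sub (integrableOn_const (by simp))).locallyIntegrableOn
  · intro χ hχ hχc hχs
    set m : ℝ := ∫ x in (0 : ℝ)..1, χ x with hm
    obtain ⟨φ, h1, h2, h3, h4⟩ := exists_test_antideriv (χ := fun x => χ x - m * ψ₀ x)
      (hχ.sub (contDiff_const.mul hψd)) (hχc.sub hψc.mul_left)
      ((tsupport_sub _ _).trans (union_subset hχs ((tsupport_mul_subset_right).trans hψs))) (by
        rw [intervalIntegral.integral_sub (hχ.continuous.intervalIntegrable _ _)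
          ((hψd.continuous.intervalIntegrable _ _).const_mul m),
          intervalIntegral.integral_const_mul, hψ1]
        simp [hm])
    have h5 := h φ h1 h2 h3
    rw [h4] at h5
    have e1 : ∫ x, χ x • (G x - c) = ∫ x in Ioo (0 : ℝ) 1, χ x • (G x - c) := by
      refine (setIntegral_eq_integral_of_forall_compl_eq_zero fun x hx => ?_).symm
      rw [image_eq_zero_of_notMem_tsupport fun h' => hx (hχs h'), zero_smul]
    have e2 : ∫ x in Ioo (0 : ℝ) 1, G x * (χ x - m * ψ₀ x)
        = (∫ x in Ioo (0 : ℝ) 1, G x * χ x) - m * c := by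
      rw [hc, ← integral_const_mul, ← integral_sub (integrableOn_mul_test hG hχ.continuous hχc)
        ((integrableOn_mul_test hG hψd.continuous hψc).const_mul m)]
      exact integral_congr_ae (Filter.Eventually.of_forall fun x => by simp only; ring)
    have e3 : ∫ x in Ioo (0 : ℝ) 1, χ x • (G x - c)
        = (∫ x in Ioo (0 : ℝ) 1, G x * χ x) - c * m := by
      rw [hm, ← integral_Ioo_eq_intervalIntegral, ← integral_const_mul,
        ← integral_sub (integrableOn_mul_test hG hχ.continuous hχc)
        ((hχ.continuous.integrable_of_hasCompactSupport hχc).integrableOn.const_mul c)]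
      exact integral_congr_ae (Filter.Eventually.of_forall fun x => by
        simp only [smul_eq_mul]; ring)
    rw [e1, e3]
    linarith

/-- A function with an integrable weak derivative is a primitive of it. -/
theorem HasWeakDeriv.ae_eq_primitive {g g' : ℝ → ℝ} (h : HasWeakDeriv g g')
    (hg : IntegrableOn g (Ioo 0 1)) (hg' : IntegrableOn g' (Ioo 0 1)) :
    ∃ c : ℝ, ∀ᵐ x, x ∈ Ioo (0 : ℝ) 1 → g x = c + ∫ t in (0 : ℝ)..x, g' t := by
  have hg'i : IntervalIntegrable g' volume 0 1 :=
    (intervalIntegrable_iff_integrableOn_Ioo_of_le zero_le_one).2 hg'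
  set I : ℝ → ℝ := fun x => ∫ t in (0 : ℝ)..x, g' t with hI
  have hIac : AbsolutelyContinuousOnInterval I 0 1 :=
    hg'i.absolutelyContinuousOnInterval_intervalIntegral (c := 0) (by simp)
  have hIcont : ContinuousOn I (Icc 0 1) := by
    simpa [uIcc_of_le (zero_le_one (α := ℝ))] using hIac.continuousOn
  have hIint : IntegrableOn I (Ioo 0 1) :=
    (hIcont.integrableOn_Icc).mono_set Ioo_subset_Icc_self
  obtain ⟨c, hc⟩ := exists_ae_eq_const (G := fun x => g x - I x) (hg.sub hIint) (by
    intro φ hφ hφc hφs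
    have hφ' : Continuous (deriv φ) := hφ.continuous_deriv (by simp)
    have hφac : AbsolutelyContinuousOnInterval φ 0 1 :=
      ContDiffOn.absolutelyContinuousOnInterval (hφ.contDiffOn.of_le (by simp))
    have hparts := hIac.integral_mul_deriv_eq_deriv_mul hφac
    have hφ0 : φ 0 = 0 := image_eq_zero_of_notMem_tsupport fun h' => by simpa using (hφs h').1
    have hφ1 : φ 1 = 0 := image_eq_zero_of_notMem_tsupport fun h' => by simpa using (hφs h').2
    have hcongr : ∫ x in (0 : ℝ)..1, deriv I x * φ x = ∫ x in (0 : ℝ)..1, g' x * φ x := by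
      apply intervalIntegral.integral_congr_ae
      filter_upwards [hg'i.ae_hasDerivAt_integral] with x hx hx'
      rw [(hx (uIoc_subset_uIcc hx') 0 (by simp)).deriv]
    rw [hcongr, hφ0, hφ1] at hparts
    have hw := h φ hφ hφc hφs
    have e : ∫ x in Ioo (0 : ℝ) 1, (g x - I x) * deriv φ x
        = (∫ x in Ioo (0 : ℝ) 1, g x * deriv φ x) - ∫ x in Ioo (0 : ℝ) 1, I x * deriv φ x := by
      rw [← integral_sub (integrableOn_mul_test hg hφ' hφc.deriv) (integrableOn_mul_test hIint hφ' hφc.deriv)]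
      exact integral_congr_ae (Filter.Eventually.of_forall fun x => by simp only; ring)
    rw [e, hw, integral_Ioo_eq_intervalIntegral, integral_Ioo_eq_intervalIntegral, hparts]
    ring)
  refine ⟨c, ?_⟩
  filter_upwards [hc] with x hx hx'
  linarith [hx hx']

theorem HasWeakDeriv.ae_unique {g v w : ℝ → ℝ} (hv : HasWeakDeriv g v) (hw : HasWeakDeriv g w)
    (hvi : IntegrableOn v (Ioo 0 1)) (hwi : IntegrableOn w (Ioo 0 1)) :
    ∀ᵐ x, x ∈ Ioo (0 : ℝ) 1 → v x = w x := by
  have key := isOpen_Ioo.ae_eq_zero_of_integral_contDiff_smul_eq_zero (μ := volume)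
    (U := Ioo (0 : ℝ) 1) (f := fun x => v x - w x) (hvi.sub hwi).locallyIntegrableOn ?_
  · filter_upwards [key] with x hx hx'
    exact sub_eq_zero.1 (hx hx')
  · intro φ hφ hφc hφs
    have e1 : ∫ x, φ x • (v x - w x) = ∫ x in Ioo (0 : ℝ) 1, (v x * φ x - w x * φ x) := by
      rw [← setIntegral_eq_integral_of_forall_compl_eq_zero (s := Ioo (0 : ℝ) 1)]
      · exact integral_congr_ae (Filter.Eventually.of_forall fun x => by
          simp only [smul_eq_mul]; ring)
      · intro x hx
        rw [image_eq_zero_of_notMem_tsupport fun h' => hx (hφs h'), zero_smul]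
    rw [e1, integral_sub (integrableOn_mul_test hvi hφ.continuous hφc)
      (integrableOn_mul_test hwi hφ.continuous hφc)]
    linarith [hv φ hφ hφc hφs, hw φ hφ hφc hφs]

/-! ### From almost everywhere identities to a classical representative. -/

theorem eqOn_Icc_of_ae_eq_Ioo {F G : ℝ → ℝ} (hF : ContinuousOn F (Icc 0 1))
    (hG : ContinuousOn G (Icc 0 1)) (h : ∀ᵐ x, x ∈ Ioo (0 : ℝ) 1 → F x = G x) :
    EqOn F G (Icc 0 1) := by
  refine Measure.eqOn_Icc_of_ae_eq volume zero_ne_one ?_ hF hG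
  rw [← restrict_Ioo_eq_restrict_Icc]
  exact (ae_restrict_iff' measurableSet_Ioo).2 h

theorem intervalIntegral_congr_of_ae_eq_Ioo {F G : ℝ → ℝ}
    (h : ∀ᵐ x, x ∈ Ioo (0 : ℝ) 1 → F x = G x) {x : ℝ} (hx : x ∈ Icc (0 : ℝ) 1) :
    ∫ t in (0 : ℝ)..x, F t = ∫ t in (0 : ℝ)..x, G t := by
  rw [intervalIntegral.integral_of_le hx.1, intervalIntegral.integral_of_le hx.1,
    integral_Ioc_eq_integral_Ioo, integral_Ioc_eq_integral_Ioo]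
  refine setIntegral_congr_ae measurableSet_Ioo ?_
  filter_upwards [h] with t ht ht'
  exact ht ⟨ht'.1, ht'.2.trans_le hx.2⟩

/-- Cauchy–Schwarz, read off from `∫ ((y - x) g - I)² ≥ 0`. -/
theorem sq_intervalIntegral_le {g : ℝ → ℝ} {x y : ℝ} (hxy : x ≤ y)
    (hg : IntervalIntegrable g volume x y)
    (hg2 : IntervalIntegrable (fun t => g t ^ 2) volume x y) :
    (∫ t in x..y, g t) ^ 2 ≤ (y - x) * ∫ t in x..y, g t ^ 2 := by
  rcases hxy.eq_or_lt with rfl | hlt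
  · simp
  set I := ∫ t in x..y, g t with hI
  set Q := ∫ t in x..y, g t ^ 2 with hQ
  have h0 : 0 ≤ ∫ t in x..y, ((y - x) * g t - I) ^ 2 :=
    intervalIntegral.integral_nonneg hxy fun t _ => sq_nonneg _
  have e : ∫ t in x..y, ((y - x) * g t - I) ^ 2
      = (y - x) ^ 2 * Q - 2 * (y - x) * I * I + (y - x) * I ^ 2 := by
    have : ∀ t, ((y - x) * g t - I) ^ 2
        = ((y - x) ^ 2 * g t ^ 2 - 2 * (y - x) * I * g t) + I ^ 2 := fun t => by ring
    simp_rw [this]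
    rw [intervalIntegral.integral_add ((hg2.const_mul _).sub (hg.const_mul _))
      intervalIntegrable_const, intervalIntegral.integral_sub (hg2.const_mul _) (hg.const_mul _),
      intervalIntegral.integral_const_mul, intervalIntegral.integral_const_mul,
      intervalIntegral.integral_const, smul_eq_mul]
  rw [e] at h0
  have hpos : 0 < y - x := sub_pos.2 hlt
  have : 0 ≤ (y - x) * ((y - x) * Q - I ^ 2) := by linarith
  nlinarith [nonneg_of_mul_nonneg_right this hpos]

/-- The solution `u` of the Poisson problem coincides on `[0,1]` with a `C²` function `U` whose
second derivative has the modulus of continuity of a primitive of an `L²` function. -/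
theorem exists_regular_representative {f u : ℝ → ℝ} (hf : MemL2 f) (hsol : IsPoissonSolution f u)
    (hu : MemSobolev 3 u) :
    ∃ U U₁ U₂ Γ : ℝ → ℝ, (∀ x ∈ Icc (0 : ℝ) 1, u x = U x) ∧
      (∀ x, HasDerivAt U (U₁ x) x) ∧ (∀ x, HasDerivAt U₁ (U₂ x) x) ∧ Continuous U₂ ∧
      (∀ x y, 0 ≤ x → x ≤ y → y ≤ 1 → (U₂ y - U₂ x) ^ 2 ≤ (y - x) * (Γ y - Γ x)) ∧
      (∀ x y, 0 ≤ x → x ≤ y → y ≤ 1 → Γ x ≤ Γ y) ∧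
      (∀ x y, 0 ≤ x → x ≤ y → y ≤ 1 → ∫ t in x..y, f t = U₁ x - U₁ y) ∧
      U 0 = 0 ∧ U 1 = 0 := by
  obtain ⟨hu0, v₁, hv₁, hv₁L, v₂, hv₂, hv₂L, v₃, hv₃, hv₃L⟩ := hu
  change MemL2 v₃ at hv₃L
  obtain ⟨c₂, hc₂⟩ := hv₃.ae_eq_primitive hv₂L.integrableOn hv₃L.integrableOn
  obtain ⟨c₁, hc₁⟩ := hv₂.ae_eq_primitive hv₁L.integrableOn hv₂L.integrableOn
  obtain ⟨c₀, hc₀⟩ := hv₁.ae_eq_primitive hu0.integrableOn hv₁L.integrableOn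
  -- The extension by zero is integrable on the whole line, so the repeated primitives are
  -- differentiable at every real point, not only inside the interval.
  set g : ℝ → ℝ := (Ioo (0 : ℝ) 1).indicator v₃ with hg
  have hgi : Integrable g := hv₃L.integrableOn.integrable_indicator measurableSet_Ioo
  have hg2 : Integrable (fun x => g x ^ 2) := by
    have h2 : IntegrableOn (fun x => v₃ x ^ 2) (Ioo 0 1) := MemLp.integrable_sq hv₃L
    refine (h2.integrable_indicator measurableSet_Ioo).congr (Filter.Eventually.of_forall ?_)
    intro x
    by_cases hx : x ∈ Ioo (0 : ℝ) 1 <;> simp [hg, hx]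
  have hgv : ∀ᵐ x, x ∈ Ioo (0 : ℝ) 1 → v₃ x = g x :=
    Filter.Eventually.of_forall fun x hx => by simp [hg, hx]
  set U₂ : ℝ → ℝ := fun x => c₂ + ∫ t in (0 : ℝ)..x, g t with hU₂
  have hU₂c : Continuous U₂ :=
    continuous_const.add (intervalIntegral.continuous_primitive (fun _ _ => hgi.intervalIntegrable) 0)
  have h2 : ∀ᵐ x, x ∈ Ioo (0 : ℝ) 1 → v₂ x = U₂ x := by
    filter_upwards [hc₂] with x hx hx'
    rw [hx hx', hU₂, intervalIntegral_congr_of_ae_eq_Ioo hgv (Ioo_subset_Icc_self hx')]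
  set U₁ : ℝ → ℝ := fun x => c₁ + ∫ t in (0 : ℝ)..x, U₂ t with hU₁
  have hprim : ∀ (F : ℝ → ℝ) (c : ℝ), Continuous F →
      ∀ x, HasDerivAt (fun x => c + ∫ t in (0 : ℝ)..x, F t) (F x) x := fun F c hF x =>
    (intervalIntegral.integral_hasDerivAt_right (hF.intervalIntegrable _ _)
      (hF.stronglyMeasurableAtFilter _ _) hF.continuousAt).const_add c
  have hU₁d : ∀ x, HasDerivAt U₁ (U₂ x) x := hprim U₂ c₁ hU₂c
  have hU₁c : Continuous U₁ := continuous_iff_continuousAt.2 fun x => (hU₁d x).continuousAt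
  have h1 : ∀ᵐ x, x ∈ Ioo (0 : ℝ) 1 → v₁ x = U₁ x := by
    filter_upwards [hc₁] with x hx hx'
    rw [hx hx', hU₁, intervalIntegral_congr_of_ae_eq_Ioo h2 (Ioo_subset_Icc_self hx')]
  set U : ℝ → ℝ := fun x => c₀ + ∫ t in (0 : ℝ)..x, U₁ t with hU
  have hUd : ∀ x, HasDerivAt U (U₁ x) x := hprim U₁ c₀ hU₁c
  have hUc : Continuous U := continuous_iff_continuousAt.2 fun x => (hUd x).continuousAt
  have h0 : ∀ᵐ x, x ∈ Ioo (0 : ℝ) 1 → u x = U x := by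
    filter_upwards [hc₀] with x hx hx'
    rw [hx hx', hU, intervalIntegral_congr_of_ae_eq_Ioo h1 (Ioo_subset_Icc_self hx')]
  have huU : EqOn u U (Icc 0 1) := eqOn_Icc_of_ae_eq_Ioo hsol.continuousOn hUc.continuousOn h0
  obtain ⟨w, hwL, hw, hwf⟩ := hsol.equation
  have hfi : IntegrableOn f (Ioo 0 1) := hf.integrableOn
  obtain ⟨c, hc⟩ := hwf.ae_eq_primitive hwL.integrableOn hfi.neg
  have hfii : IntervalIntegrable f volume 0 1 :=
    (intervalIntegrable_iff_integrableOn_Ioo_of_le zero_le_one).2 hfi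
  have hfsub : ∀ x y, x ∈ Icc (0 : ℝ) 1 → y ∈ Icc (0 : ℝ) 1 →
      IntervalIntegrable f volume x y := fun x y hx hy =>
    hfii.mono_set (by
      rw [uIcc_of_le (zero_le_one (α := ℝ))]
      exact uIcc_subset_Icc hx hy)
  have hWc : ContinuousOn (fun x => c + ∫ t in (0 : ℝ)..x, -f t) (Icc 0 1) := by
    have h' := (hfii.neg.absolutelyContinuousOnInterval_intervalIntegral (c := 0)
      (by simp)).continuousOn
    rw [uIcc_of_le (zero_le_one (α := ℝ))] at h'
    exact continuousOn_const.add h'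
  -- The weak derivative in the equation and the one from `H³` agree almost everywhere, so `U₁` is a
  -- primitive of `-f` on `[0,1]`; this yields the cell integrals of `f` as differences of `U₁`.
  have hUW : EqOn U₁ (fun x => c + ∫ t in (0 : ℝ)..x, -f t) (Icc 0 1) := by
    refine eqOn_Icc_of_ae_eq_Ioo hU₁c.continuousOn hWc ?_
    filter_upwards [h1, hc, hv₁.ae_unique hw hv₁L.integrableOn hwL.integrableOn] with x a b d hx
    rw [← a hx, d hx, b hx]
  refine ⟨U, U₁, U₂, fun x => ∫ t in (0 : ℝ)..x, g t ^ 2, huU, hUd, hU₁d, hU₂c, ?_, ?_, ?_, ?_, ?_⟩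
  · intro x y _ hxy _
    have e1 : U₂ y - U₂ x = ∫ t in x..y, g t := by
      simp only [hU₂]
      rw [add_sub_add_left_eq_sub, intervalIntegral.integral_interval_sub_left
        hgi.intervalIntegrable hgi.intervalIntegrable]
    rw [e1, intervalIntegral.integral_interval_sub_left
        hg2.intervalIntegrable hg2.intervalIntegrable]
    exact sq_intervalIntegral_le hxy hgi.intervalIntegrable hg2.intervalIntegrable
  · intro x y _ hxy _
    rw [← sub_nonneg, intervalIntegral.integral_interval_sub_left
        hg2.intervalIntegrable hg2.intervalIntegrable]
    exact intervalIntegral.integral_nonneg hxy fun t _ => sq_nonneg _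
  · intro x y hx hxy hy
    have hx' : x ∈ Icc (0 : ℝ) 1 := ⟨hx, hxy.trans hy⟩
    have hy' : y ∈ Icc (0 : ℝ) 1 := ⟨hx.trans hxy, hy⟩
    have h00 : (0 : ℝ) ∈ Icc (0 : ℝ) 1 := by simp
    rw [hUW hx', hUW hy']
    simp only [intervalIntegral.integral_neg]
    rw [← intervalIntegral.integral_interval_sub_left (hfsub 0 y h00 hy') (hfsub 0 x h00 hx')]
    ring
  · rw [← huU (by simp)]
    exact hsol.left_eq_zero
  · rw [← huU (by simp)]
    exact hsol.right_eq_zero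

/-! ### The reconstruction in terms of nodal derivatives -/

theorem meshSize_pos {N : ℕ} (hN : 2 ≤ N) : 0 < meshSize N := by
  have : (0 : ℝ) < N := by exact_mod_cast (by omega : 0 < N)
  unfold meshSize
  positivity

theorem natCast_mul_meshSize {N : ℕ} (hN : 2 ≤ N) : (N : ℝ) * meshSize N = 1 := by
  have : (N : ℝ) ≠ 0 := by exact_mod_cast (by omega : N ≠ 0)
  unfold meshSize
  field_simp

theorem node_succ (N i : ℕ) : node N (i + 1) = node N i + meshSize N := by
  unfold node
  push_cast
  ring

theorem node_zero (N : ℕ) : node N 0 = 0 := by simp [node]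

theorem node_self {N : ℕ} (hN : 2 ≤ N) : node N N = 1 := natCast_mul_meshSize hN

theorem one_sub_node {N j : ℕ} (hN : 2 ≤ N) (hj : j + 1 = N) : 1 - node N j = meshSize N := by
  have h1 := natCast_mul_meshSize hN
  have h2 : (N : ℝ) = j + 1 := by rw [← hj]; push_cast; ring
  unfold node
  linear_combination -h1 + meshSize N * h2

/-- The quadratic polynomial with Taylor coefficients `α, β, γ` at `c`. -/
noncomputable def quad (c α β γ : ℝ) : ℝ[X] :=
  C α + C β * (X - C c) + C γ * (X - C c) ^ 2

theorem eval_quad (c α β γ x : ℝ) :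
    (quad c α β γ).eval x = α + β * (x - c) + γ * (x - c) ^ 2 := by
  simp [quad]

theorem eval_derivative_quad (c α β γ x : ℝ) :
    (derivative (quad c α β γ)).eval x = β + 2 * γ * (x - c) := by
  simp [quad, derivative_pow]
  ring

theorem natDegree_quad_le (c α β γ : ℝ) : (quad c α β γ).natDegree ≤ 2 := by
  unfold quad
  compute_degree

theorem exists_eq_quad {p : ℝ[X]} (hp : p.natDegree ≤ 2) (c : ℝ) :
    ∃ α β γ, p = quad c α β γ := by
  refine ⟨p.coeff 0 + p.coeff 1 * c + p.coeff 2 * c ^ 2, p.coeff 1 + 2 * p.coeff 2 * c,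
    p.coeff 2, ?_⟩
  conv_lhs => rw [p.as_sum_range_C_mul_X_pow' (n := 3) (by omega)]
  simp only [Finset.sum_range_succ, Finset.sum_range_zero, quad, C_add, C_mul, C_pow]
  simp only [pow_zero, pow_one, mul_one, zero_add, map_ofNat]
  ring

theorem integral_quad (c α β γ h r : ℝ) :
    ∫ x in (c + r * h)..(c + r * h + h), (quad c α β γ).eval x
      = h * (α + β * h * (2 * r + 1) / 2 + γ * h ^ 2 * (3 * r ^ 2 + 3 * r + 1) / 3) := by
  have hd : ∀ x ∈ uIcc (c + r * h) (c + r * h + h), HasDerivAt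
      (fun x => α * x + β * (x - c) ^ 2 / 2 + γ * (x - c) ^ 3 / 3)
      ((quad c α β γ).eval x) x := by
    intro x _
    rw [eval_quad]
    have h1 : HasDerivAt (fun x : ℝ => x - c) 1 x := (hasDerivAt_id x).sub_const c
    convert! (((hasDerivAt_id x).const_mul α).add (((h1.pow 2).const_mul β).div_const 2)).add
      (((h1.pow 3).const_mul γ).div_const 3) using 1
    simp
    ring
  rw [intervalIntegral.integral_eq_sub_of_hasDerivAt hd
    ((quad c α β γ).continuous.intervalIntegrable _ _)]
  ring

/-- The relations between the cell averages `a` of a reduced function and the derivatives `d` of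
its reconstruction at the nodes. -/
structure IsStencil (N : ℕ) (a d : ℕ → ℝ) : Prop where
  interior : ∀ i, i + 1 < N → a (i + 1) = a i + meshSize N * d (i + 1)
  left : a 0 = meshSize N * (2 * d 0 + d 1) / 6
  right : a (N - 1) = -(meshSize N * (2 * d N + d (N - 1)) / 6)

/-- The quadratic polynomial on the `j`-th cell with average `a j` and end point derivatives
`d j`, `d (j + 1)`. -/
noncomputable def recPoly (N : ℕ) (a d : ℕ → ℝ) (j : ℕ) : ℝ[X] :=
  quad (node N j) (a j - meshSize N * (2 * d j + d (j + 1)) / 6) (d j)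
    ((d (j + 1) - d j) / (2 * meshSize N))

theorem integral_const_cell (N i : ℕ) (c : ℝ) :
    ∫ _ in node N i..node N (i + 1), c = meshSize N * c := by
  rw [intervalIntegral.integral_const, node_succ]
  simp

theorem integral_quad_self (N j : ℕ) (α β γ : ℝ) :
    ∫ x in node N j..node N (j + 1), (quad (node N j) α β γ).eval x
      = meshSize N * (α + β * meshSize N / 2 + γ * meshSize N ^ 2 / 3) := by
  have := integral_quad (node N j) α β γ (meshSize N) 0
  rw [zero_mul, add_zero, ← node_succ] at this
  rw [this]
  ring

theorem integral_quad_next (N j : ℕ) (α β γ : ℝ) :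
    ∫ x in node N (j + 1)..node N (j + 2), (quad (node N j) α β γ).eval x
      = meshSize N * (α + 3 * β * meshSize N / 2 + 7 * γ * meshSize N ^ 2 / 3) := by
  have := integral_quad (node N j) α β γ (meshSize N) 1
  rw [one_mul, ← node_succ, ← node_succ] at this
  rw [this]
  ring

theorem integral_quad_prev (N j : ℕ) (α β γ : ℝ) :
    ∫ x in node N j..node N (j + 1), (quad (node N (j + 1)) α β γ).eval x
      = meshSize N * (α - β * meshSize N / 2 + γ * meshSize N ^ 2 / 3) := by
  have := integral_quad (node N (j + 1)) α β γ (meshSize N) (-1)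
  rw [show node N (j + 1) + -1 * meshSize N = node N j by rw [node_succ]; ring,
    ← node_succ] at this
  rw [this]
  ring

theorem isReconstruction_recPoly {N : ℕ} (hN : 2 ≤ N) {a d : ℕ → ℝ} (h : IsStencil N a d)
    {w : Broken N} (hw : ∀ (j : Fin N) x, w j x = a j) :
    IsReconstruction w fun j => recPoly N a d j := by
  have hpos := meshSize_pos hN
  refine ⟨fun j => natDegree_quad_le _ _ _ _, ?_, ?_, ?_⟩
  · intro j j' h1 h2
    simp_rw [hw]
    rw [integral_const_cell]
    obtain ⟨j, hj⟩ := j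
    obtain ⟨j', hj'⟩ := j'
    simp only [recPoly] at h1 h2 ⊢
    obtain rfl | rfl | rfl : j' = j ∨ j' = j + 1 ∨ j = j' + 1 := by omega
    · rw [integral_quad_self]
      field_simp
      ring
    · rw [integral_quad_next, h.interior j (by omega)]
      field_simp
      ring
    · rw [integral_quad_prev, h.interior j' (by omega)]
      field_simp
      ring
  · intro j hj
    simp only [recPoly, hj, eval_quad, node_zero, h.left]
    ring
  · intro j hj
    have hr := h.right
    have e : N - 1 = j.val := by omega
    have e1 : (1 : ℝ) - node N j = meshSize N := one_sub_node hN hj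
    have e2 : d (j + 1) = d N := by rw [hj]
    rw [e] at hr
    simp only [recPoly, eval_quad, e1, e2, hr]
    field_simp
    ring

/-- The derivative at an interior node is the difference quotient of the two adjacent averages,
whichever of the two cells it is computed from. -/
theorem IsReconstruction.exists_eq_recPoly {N : ℕ} (hN : 2 ≤ N) {a : ℕ → ℝ} {w : Broken N}
    (hw : ∀ (j : Fin N) x, w j x = a j) {p : Fin N → ℝ[X]} (hp : IsReconstruction w p) :
    ∃ d, IsStencil N a d ∧ ∀ j, p j = recPoly N a d j := by
  have hpos := meshSize_pos hN
  have hint : ∀ j j' : Fin N, j'.val ≤ j.val + 1 → j.val ≤ j'.val + 1 →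
      ∫ x in node N j'..node N (j' + 1), (p j).eval x = meshSize N * a j' := by
    intro j j' h1 h2
    rw [hp.integral_eq j j' h1 h2]
    simp_rw [hw]
    rw [integral_const_cell]
  set h := meshSize N with hh
  -- At the left end, a quadratic with `p(0) = 0` and averages `a 0`, `a 1` satisfies `2 h p'(0) = 7
  -- a 0 - a 1`; the right end is its reflection.
  refine ⟨fun i => if i = 0 then (7 * a 0 - a 1) / (2 * h) else
    if i = N then -((7 * a (N - 1) - a (N - 2)) / (2 * h)) else (a i - a (i - 1)) / h, ?_, ?_⟩
  · refine ⟨fun i hi => ?_, ?_, ?_⟩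
    · rw [if_neg (by omega), if_neg (by omega), Nat.add_sub_cancel, ← hh]
      field_simp
      ring
    · rw [if_pos rfl, if_neg one_ne_zero, if_neg (by omega), ← hh]
      field_simp
      ring
    · rw [if_neg (by omega), if_pos rfl, if_neg (by omega), if_neg (by omega), ← hh,
        Nat.sub_sub]
      field_simp
      ring
  · rintro ⟨j, hj⟩
    obtain ⟨α, β, γ, hq⟩ := exists_eq_quad (hp.natDegree_le ⟨j, hj⟩) (node N j)
    have h0 := hint ⟨j, hj⟩ ⟨j, hj⟩ (by simp) (by simp)
    rw [hq] at h0
    simp only [integral_quad_self] at h0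
    have h0' := mul_left_cancel₀ hpos.ne' h0
    have hnext : j + 1 < N → α + 3 * β * h / 2 + 7 * γ * h ^ 2 / 3 = a (j + 1) := by
      intro hj1
      have h1 := hint ⟨j, hj⟩ ⟨j + 1, hj1⟩ (by simp) (by simp; omega)
      rw [hq] at h1
      simp only [integral_quad_next] at h1
      exact mul_left_cancel₀ hpos.ne' h1
    have hprev : 0 < j → α - β * h / 2 + γ * h ^ 2 / 3 = a (j - 1) := by
      intro hj1
      obtain ⟨k, rfl⟩ : ∃ k, j = k + 1 := ⟨j - 1, by omega⟩
      have h1 := hint ⟨k + 1, hj⟩ ⟨k, by omega⟩ (by simp; omega) (by simp)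
      rw [hq] at h1
      simp only [integral_quad_prev] at h1
      exact mul_left_cancel₀ hpos.ne' h1
    have hleft : j = 0 → α = 0 := by
      rintro rfl
      have h1 := hp.left_eq_zero ⟨0, hj⟩ rfl
      rw [hq, eval_quad, node_zero] at h1
      linarith
    have hright : j + 1 = N → α + β * h + γ * h ^ 2 = 0 := by
      intro hj1
      have h1 := hp.right_eq_zero ⟨j, hj⟩ hj1
      rw [hq, eval_quad] at h1
      simp only [one_sub_node hN hj1] at h1
      exact h1
    rw [hq]
    simp only [recPoly, ← hh]
    have h2 : (2 * h) ≠ 0 := by positivity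
    rcases Nat.eq_zero_or_pos j with rfl | hj0
    · rw [if_pos rfl, if_neg (by omega), if_neg (by omega), Nat.add_sub_cancel]
      have e1 := hnext (by omega)
      have e2 := hleft rfl
      have hβ : β = (7 * a 0 - a 1) / (2 * h) := by
        rw [eq_div_iff h2]
        subst e2
        linear_combination 7 * h0' - e1
      have hγ : γ * h ^ 2 = 3 / 4 * (a 1 - 3 * a 0) := by
        subst e2
        linear_combination 3 / 4 * (e1 - 3 * h0')
      congr 1
      · rw [e2]
        field_simp
        ring
      · rw [eq_div_iff h2]
        field_simp
        linear_combination 4 * hγ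
    · rw [if_neg (by omega), if_neg (by omega), if_neg (by omega), Nat.add_sub_cancel]
      have e1 := hprev hj0
      have hβh : β * h = a j - a (j - 1) := by linear_combination h0' - e1
      have hβ : β = (a j - a (j - 1)) / h := by rw [eq_div_iff hpos.ne', hβh]
      by_cases hjN : j + 1 = N
      · rw [if_pos hjN]
        have e2 := hright hjN
        have i1 : N - 1 = j := by omega
        have i2 : N - 2 = j - 1 := by omega
        rw [i1, i2]
        have hγ : γ * h ^ 2 = 3 / 4 * (a (j - 1) - 3 * a j) := by
          linear_combination 3 / 4 * (e1 - 3 * h0') + 3 / 2 * e2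
        congr 1
        · field_simp
          linear_combination 12 * h0' - 6 * hβh - 4 * hγ
        · rw [eq_div_iff h2]
          field_simp
          linear_combination 4 * hγ
      · rw [if_neg hjN]
        have e2 := hnext (by omega)
        have hγ : γ * h ^ 2 = (a (j + 1) - 2 * a j + a (j - 1)) / 2 := by
          linear_combination 1 / 2 * (e2 - 2 * h0' + e1)
        congr 1
        · field_simp
          linear_combination 6 * h0' - 3 * hβh - 2 * hγ
        · rw [eq_div_iff h2]
          field_simp
          linear_combination 2 * hγ

theorem mem_rdgSpace_iff {N : ℕ} (hN : 2 ≤ N) {p : Fin N → ℝ[X]} :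
    p ∈ rdgSpace N ↔ ∃ a d, IsStencil N a d ∧ ∀ j, p j = recPoly N a d j := by
  constructor
  · rintro ⟨v, hv, hp⟩
    set a : ℕ → ℝ := fun i => if hi : i < N then (v ⟨i, hi⟩).coeff 0 else 0 with ha
    obtain ⟨d, h1, h2⟩ := hp.exists_eq_recPoly hN (a := a) (fun j x => by
      have e : v j = C ((v j).coeff 0) := eq_C_of_natDegree_le_zero (hv j)
      simp only [toBroken, ha, j.isLt, dif_pos, Fin.eta]
      rw [e]
      simp)
    exact ⟨a, d, h1, h2⟩
  · rintro ⟨a, d, h, hp⟩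
    obtain rfl : p = fun j : Fin N => recPoly N a d j := funext hp
    exact ⟨fun j => C (a j), fun j => by simp, isReconstruction_recPoly hN h fun j x => by
      simp [toBroken]⟩

theorem eval_recPoly_left (N : ℕ) (a d : ℕ → ℝ) (j : ℕ) :
    (recPoly N a d j).eval (node N j) = a j - meshSize N * (2 * d j + d (j + 1)) / 6 := by
  simp [recPoly, eval_quad]

theorem eval_recPoly_right {N : ℕ} (hN : 2 ≤ N) (a d : ℕ → ℝ) (j : ℕ) :
    (recPoly N a d j).eval (node N (j + 1)) = a j + meshSize N * (d j + 2 * d (j + 1)) / 6 := by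
  have hpos := meshSize_pos hN
  rw [recPoly, eval_quad, node_succ, add_sub_cancel_left]
  field_simp
  ring

theorem eval_derivative_recPoly (N : ℕ) (a d : ℕ → ℝ) (j : ℕ) (x : ℝ) :
    (derivative (recPoly N a d j)).eval x
      = d j + (x - node N j) / meshSize N * (d (j + 1) - d j) := by
  rw [recPoly, eval_derivative_quad]
  by_cases h : meshSize N = 0
  · simp [h]
  · field_simp

theorem eval_derivative_recPoly_left (N : ℕ) (a d : ℕ → ℝ) (j : ℕ) :
    (derivative (recPoly N a d j)).eval (node N j) = d j := by
  simp [eval_derivative_recPoly]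

theorem eval_derivative_recPoly_right {N : ℕ} (hN : 2 ≤ N) (a d : ℕ → ℝ) (j : ℕ) :
    (derivative (recPoly N a d j)).eval (node N (j + 1)) = d (j + 1) := by
  have hpos := meshSize_pos hN
  rw [eval_derivative_recPoly, node_succ, add_sub_cancel_left, div_self hpos.ne']
  ring

/-! ### Jumps and averages -/

/-- The zero convention for missing traces treats interior and boundary faces alike, so that sums
over faces can be rearranged into sums over cells. -/
theorem faceNormal_mul_jump {N : ℕ} (w : Broken N) (i : Fin (N + 1)) :
    faceNormal i * jump w i = leftTrace w i - rightTrace w i := by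
  unfold faceNormal jump
  split_ifs with h0 hN'
  · simp [leftTrace, h0]
  · simp [rightTrace, hN']
  · ring

theorem faceNormal_sq {N : ℕ} (i : Fin (N + 1)) : faceNormal i * faceNormal i = 1 := by
  unfold faceNormal
  split_ifs <;> norm_num

theorem leftTrace_succ {N : ℕ} (w : Broken N) (j : Fin N) :
    leftTrace w j.succ = w j (node N (j + 1)) := by
  simp [leftTrace]

theorem leftTrace_zero {N : ℕ} (w : Broken N) : leftTrace w 0 = 0 := by
  simp [leftTrace]

theorem rightTrace_castSucc {N : ℕ} (w : Broken N) (j : Fin N) :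
    rightTrace w j.castSucc = w j (node N j) := by
  simp [rightTrace]

theorem rightTrace_last {N : ℕ} (w : Broken N) : rightTrace w (Fin.last N) = 0 := by
  simp [rightTrace]

theorem node_lt_succ {N : ℕ} (hN : 2 ≤ N) (j : ℕ) : node N j < node N (j + 1) := by
  rw [node_succ]
  linarith [meshSize_pos hN]

theorem grad_toBroken {N : ℕ} (hN : 2 ≤ N) (p : Fin N → ℝ[X]) (j : Fin N) {x : ℝ}
    (hx : x ∈ cell N j) : grad (toBroken p) j x = (derivative (p j)).eval x :=
  (p j).derivWithin (uniqueDiffOn_Icc (node_lt_succ hN j) x hx)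

theorem left_mem_cell {N : ℕ} (hN : 2 ≤ N) (j : Fin N) : node N j ∈ cell N j :=
  left_mem_Icc.2 (node_lt_succ hN j).le

theorem right_mem_cell {N : ℕ} (hN : 2 ≤ N) (j : Fin N) : node N (j + 1) ∈ cell N j :=
  right_mem_Icc.2 (node_lt_succ hN j).le

theorem grad_toBroken_const {N : ℕ} {v : Fin N → ℝ[X]} (hv : v ∈ dgSpace N 0) :
    grad (toBroken v) = 0 := by
  funext j x
  have e : v j = C ((v j).coeff 0) := eq_C_of_natDegree_le_zero (hv j)
  have : toBroken v j = fun _ => (v j).coeff 0 := by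
    funext y
    simp only [toBroken]
    rw [e]
    simp
  simp [grad, this]

/-- The numerical flux at the `i`-th node. -/
noncomputable def flux (η : ℝ) (N : ℕ) (d : ℕ → ℝ) (i : ℕ) : ℝ :=
  if i = 0 ∨ i = N then -d i else -d i + η / 6 * (d (i - 1) - 2 * d i + d (i + 1))

/-- The end point values of the two quadratics differ by `a k - a (k + 1)` plus multiples of `d`;
the stencil relation removes the averages. The boundary jumps vanish because the reconstruction
satisfies the boundary condition. -/
theorem leftTrace_sub_rightTrace_recPoly {N : ℕ} (hN : 2 ≤ N) {a d : ℕ → ℝ}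
    (h : IsStencil N a d) (i : Fin (N + 1)) :
    leftTrace (toBroken fun j : Fin N => recPoly N a d j) i
        - rightTrace (toBroken fun j : Fin N => recPoly N a d j) i
      = if i.val = 0 ∨ i.val = N then 0
        else meshSize N / 6 * (d (i - 1) - 2 * d i + d (i + 1)) := by
  obtain ⟨i, hi⟩ := i
  rcases Nat.eq_zero_or_pos i with rfl | h0
  · simp only [leftTrace, rightTrace, toBroken, lt_irrefl, dite_false, true_or, if_true,
      (by omega : 0 < N), dite_true, eval_recPoly_left, h.left]
    ring
  · obtain ⟨k, rfl⟩ : ∃ k, i = k + 1 := ⟨i - 1, by omega⟩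
    have hl : leftTrace (toBroken fun j : Fin N => recPoly N a d j) ⟨k + 1, hi⟩
        = a k + meshSize N * (d k + 2 * d (k + 1)) / 6 := by
      simp only [leftTrace, toBroken, h0, dite_true, Nat.add_sub_cancel]
      exact eval_recPoly_right hN a d k
    rw [hl]
    by_cases hkN : k + 1 = N
    · have hr := h.right
      rw [show N - 1 = k by omega, ← hkN] at hr
      simp only [rightTrace, hkN, lt_irrefl, dite_false, or_true, if_true]
      rw [← hkN, hr]
      ring
    · have hr : rightTrace (toBroken fun j : Fin N => recPoly N a d j) ⟨k + 1, hi⟩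
          = a (k + 1) - meshSize N * (2 * d (k + 1) + d (k + 2)) / 6 := by
        simp only [rightTrace, toBroken, (by omega : k + 1 < N), dite_true]
        exact eval_recPoly_left N a d (k + 1)
      rw [hr, if_neg (by simp; omega), h.interior k (by omega)]
      simp only [Nat.add_sub_cancel]
      ring

theorem avg_grad_recPoly {N : ℕ} (hN : 2 ≤ N) (a d : ℕ → ℝ) (i : Fin (N + 1)) :
    avg (grad (toBroken fun j : Fin N => recPoly N a d j)) i = d i := by
  have hl : ∀ j : Fin N, leftTrace (grad (toBroken fun j : Fin N => recPoly N a d j)) j.succ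
      = d (j + 1) := fun j => by
    rw [leftTrace_succ, grad_toBroken hN _ _ (right_mem_cell hN j),
      eval_derivative_recPoly_right hN]
  have hr : ∀ j : Fin N, rightTrace (grad (toBroken fun j : Fin N => recPoly N a d j)) j.castSucc
      = d j := fun j => by
    rw [rightTrace_castSucc, grad_toBroken hN _ _ (left_mem_cell hN j),
      eval_derivative_recPoly_left]
  have hl' : i.val ≠ 0 →
      leftTrace (grad (toBroken fun j : Fin N => recPoly N a d j)) i = d i := by
    intro h0
    have := hl ⟨i.val - 1, by omega⟩
    have e : (⟨i.val - 1, by omega⟩ : Fin N).succ = i := Fin.ext (by simp; omega)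
    rw [e] at this
    rw [this]
    congr 1
    simp only
    omega
  have hr' : i.val ≠ N →
      rightTrace (grad (toBroken fun j : Fin N => recPoly N a d j)) i = d i := fun h0 =>
    hr ⟨i.val, by omega⟩
  unfold avg
  split_ifs with h0 h1
  · exact hr' (by omega)
  · exact hl' h0
  · rw [hl' h0, hr' h1]
    ring

/-- A piecewise constant has no gradient, so only the flux and penalty terms survive; summation by
parts collects them cell by cell. -/
theorem aSip_recPoly_const {η : ℝ} {N : ℕ} (hN : 2 ≤ N) {a d : ℕ → ℝ} (h : IsStencil N a d)
    {v : Fin N → ℝ[X]} (hv : v ∈ dgSpace N 0) :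
    aSip η (toBroken fun j : Fin N => recPoly N a d j) (toBroken v)
      = ∑ j : Fin N, (flux η N d (j + 1) - flux η N d j) * (v j).coeff 0 := by
  have hpos := meshSize_pos hN
  have hval : ∀ (j : Fin N) x, toBroken v j x = (v j).coeff 0 := fun j x => by
    have e : v j = C ((v j).coeff 0) := eq_C_of_natDegree_le_zero (hv j)
    simp only [toBroken]
    rw [e]
    simp
  have havg : ∀ i : Fin (N + 1), avg (0 : Broken N) i = 0 := fun i => by
    simp [avg, leftTrace, rightTrace]
  unfold aSip
  rw [grad_toBroken_const hv]
  simp only [havg, Pi.zero_apply, mul_zero, zero_mul, intervalIntegral.integral_zero,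
    Finset.sum_const_zero, sub_zero, zero_sub]
  rw [← Finset.sum_neg_distrib, ← Finset.sum_add_distrib]
  have hterm : ∀ i : Fin (N + 1),
      -(avg (grad (toBroken fun j : Fin N => recPoly N a d j)) i * faceNormal i
          * jump (toBroken v) i)
        + η / meshSize N * (jump (toBroken fun j : Fin N => recPoly N a d j) i
          * jump (toBroken v) i)
      = flux η N d i * leftTrace (toBroken v) i - flux η N d i * rightTrace (toBroken v) i := by
    intro i
    have e1 : flux η N d i = -d i + η / meshSize N *
        (faceNormal i * jump (toBroken fun j : Fin N => recPoly N a d j) i) := by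
      rw [faceNormal_mul_jump, leftTrace_sub_rightTrace_recPoly hN h, flux]
      split_ifs
      · ring
      · field_simp
    rw [← mul_sub, ← faceNormal_mul_jump, e1, avg_grad_recPoly hN]
    linear_combination (-(η / meshSize N) * jump (toBroken fun j : Fin N => recPoly N a d j) i
          * jump (toBroken v) i) * faceNormal_sq i
  rw [Finset.sum_congr rfl fun i _ => hterm i, Finset.sum_sub_distrib, Fin.sum_univ_succ,
    Fin.sum_univ_castSucc (fun i => flux η N d i * rightTrace (toBroken v) i)]
  simp only [leftTrace_zero, rightTrace_last, leftTrace_succ, rightTrace_castSucc, hval, mul_zero,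
    zero_add, add_zero, Fin.val_succ, Fin.val_castSucc]
  rw [← Finset.sum_sub_distrib]
  exact Finset.sum_congr rfl fun j _ => by ring

theorem load_const {f : ℝ → ℝ} {N : ℕ} {v : Fin N → ℝ[X]} (hv : v ∈ dgSpace N 0) :
    load f (toBroken v)
      = ∑ j : Fin N, (∫ x in node N j..node N (j + 1), f x) * (v j).coeff 0 := by
  refine Finset.sum_congr rfl fun j _ => ?_
  have e : v j = C ((v j).coeff 0) := eq_C_of_natDegree_le_zero (hv j)
  rw [← intervalIntegral.integral_mul_const]
  simp only [toBroken]
  rw [e]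
  simp

/-- The scheme is a finite volume scheme for the nodal derivatives of the discrete solution. -/
theorem isDiscreteSolution_iff {η : ℝ} {f : ℝ → ℝ} {N : ℕ} (hN : 2 ≤ N) {p : Fin N → ℝ[X]} :
    IsDiscreteSolution η f N p ↔ ∃ a d, IsStencil N a d ∧ (∀ j, p j = recPoly N a d j) ∧
      ∀ j < N, flux η N d (j + 1) - flux η N d j = ∫ x in node N j..node N (j + 1), f x := by
  unfold IsDiscreteSolution
  rw [mem_rdgSpace_iff hN]
  constructor
  · rintro ⟨⟨a, d, h, hp⟩, hv⟩
    refine ⟨a, d, h, hp, fun j hj => ?_⟩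
    obtain rfl : p = fun j : Fin N => recPoly N a d j := funext hp
    classical
    have hmem : (Pi.single ⟨j, hj⟩ 1 : Fin N → ℝ[X]) ∈ dgSpace N 0 := by
      intro k
      by_cases hk : k = ⟨j, hj⟩
      · subst hk
        simp
      · simp [hk]
    have key := hv _ hmem
    rw [aSip_recPoly_const hN h hmem, load_const hmem, Finset.sum_eq_single ⟨j, hj⟩,
      Finset.sum_eq_single ⟨j, hj⟩] at key
    · simpa using key
    all_goals simp +contextual
  · rintro ⟨a, d, h, hp, hfl⟩
    refine ⟨⟨a, d, h, hp⟩, fun v hv => ?_⟩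
    obtain rfl : p = fun j : Fin N => recPoly N a d j := funext hp
    rw [aSip_recPoly_const hN h hv, load_const hv]
    exact Finset.sum_congr rfl fun j _ => by rw [hfl j j.isLt]

/-! ### Stability of the scheme for the nodal derivatives -/

/-- The quadrature rule whose vanishing is equivalent to the solvability of `IsStencil` for the
cell averages. -/
noncomputable def nodalQuad (N : ℕ) (d : ℕ → ℝ) : ℝ :=
  meshSize N * ∑ j ∈ Finset.range N, (d j + d (j + 1)) / 2
    + meshSize N / 6 * (d 1 - d 0 + d (N - 1) - d N)

/-- The cell averages determined by the nodal derivatives. -/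
noncomputable def cellAvg (N : ℕ) (d : ℕ → ℝ) (j : ℕ) : ℝ :=
  meshSize N * (2 * d 0 + d 1) / 6 + meshSize N * ∑ k ∈ Finset.range j, d (k + 1)

/-- The left relation fixes `a 0` and the interior relations propagate it to the last cell;
`nodalQuad` is the defect left in the right relation. -/
theorem nodalQuad_eq {N : ℕ} (hN : 2 ≤ N) (d : ℕ → ℝ) :
    nodalQuad N d = cellAvg N d (N - 1) + meshSize N * (2 * d N + d (N - 1)) / 6 := by
  obtain ⟨n, rfl⟩ : ∃ n, N = n + 1 := ⟨N - 1, by omega⟩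
  unfold nodalQuad cellAvg
  rw [← Finset.sum_div, Finset.sum_add_distrib, Finset.sum_range_succ' d,
    Finset.sum_range_succ (fun k => d (k + 1))]
  simp only [Nat.add_sub_cancel]
  ring

theorem IsStencil.eq_cellAvg {N : ℕ} {a d : ℕ → ℝ} (h : IsStencil N a d) :
    ∀ j < N, a j = cellAvg N d j := by
  intro j
  induction j with
  | zero => intro _; simp [cellAvg, h.left]
  | succ j ih =>
    intro hj
    rw [h.interior j hj, ih (by omega), cellAvg, cellAvg, Finset.sum_range_succ]
    ring

theorem IsStencil.nodalQuad_eq_zero {N : ℕ} (hN : 2 ≤ N) {a d : ℕ → ℝ} (h : IsStencil N a d) :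
    nodalQuad N d = 0 := by
  rw [nodalQuad_eq hN, ← h.eq_cellAvg (N - 1) (by omega), h.right]
  ring

theorem isStencil_cellAvg {N : ℕ} (hN : 2 ≤ N) {d : ℕ → ℝ} (h : nodalQuad N d = 0) :
    IsStencil N (cellAvg N d) d := by
  refine ⟨fun i _ => ?_, by simp [cellAvg], ?_⟩
  · rw [cellAvg, cellAvg, Finset.sum_range_succ]
    ring
  · rw [nodalQuad_eq hN] at h
    linarith

theorem sum_mul_second_diff (e : ℕ → ℝ) (n : ℕ) :
    ∑ k ∈ Finset.range n, e (k + 1) * (e k - 2 * e (k + 1) + e (k + 2))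
      = -(∑ k ∈ Finset.range (n + 1), (e (k + 1) - e k) ^ 2)
        + e (n + 1) * (e (n + 1) - e n) - e 0 * (e 1 - e 0) := by
  induction n with
  | zero => simp; ring
  | succ n ih =>
    rw [Finset.sum_range_succ, ih, Finset.sum_range_succ _ (n + 1)]
    ring

/-- Coercivity of the interior stencil of the scheme. -/
theorem sum_sq_le_of_second_diff {η c : ℝ} (hc : 0 < c) (hc1 : c ≤ 1) (hcη : c ≤ 1 + 2 * η / 3)
    {n : ℕ} {e g : ℕ → ℝ} (h0 : e 0 = 0) (hn : e (n + 1) = 0)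
    (he : ∀ k < n, e (k + 1) - η / 6 * (e k - 2 * e (k + 1) + e (k + 2)) = g k) :
    c ^ 2 * ∑ k ∈ Finset.range n, e (k + 1) ^ 2 ≤ ∑ k ∈ Finset.range n, g k ^ 2 := by
  set P := ∑ k ∈ Finset.range n, e (k + 1) ^ 2 with hP
  set D := ∑ k ∈ Finset.range (n + 1), (e (k + 1) - e k) ^ 2 with hD
  have hD0 : 0 ≤ D := Finset.sum_nonneg fun _ _ => sq_nonneg _
  have hP0 : 0 ≤ P := Finset.sum_nonneg fun _ _ => sq_nonneg _
  -- The bound `4` on the negative second difference is what produces the threshold `1 + 4 * η / 6 =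
  -- 1 + 2 * η / 3` for negative `η`.
  have hDP : D ≤ 4 * P := by
    have h1 : D ≤ ∑ k ∈ Finset.range (n + 1), (2 * e (k + 1) ^ 2 + 2 * e k ^ 2) :=
      Finset.sum_le_sum fun k _ => by nlinarith [sq_nonneg (e (k + 1) + e k)]
    rw [Finset.sum_add_distrib, Finset.sum_range_succ,
      Finset.sum_range_succ' (fun k => 2 * e k ^ 2), ← Finset.mul_sum, ← hP, h0, hn] at h1
    linarith
  -- Energy identity: multiply the difference equation by `e` and sum by parts.
  have hsum : ∑ k ∈ Finset.range n, e (k + 1) * g k = P + η / 6 * D := by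
    have h1 := sum_mul_second_diff e n
    rw [h0, hn, ← hD] at h1
    have : ∑ k ∈ Finset.range n, e (k + 1) * g k = P - η / 6 *
        ∑ k ∈ Finset.range n, e (k + 1) * (e k - 2 * e (k + 1) + e (k + 2)) := by
      rw [hP, Finset.mul_sum, ← Finset.sum_sub_distrib]
      refine Finset.sum_congr rfl fun k hk => ?_
      rw [← he k (Finset.mem_range.1 hk)]
      ring
    rw [this, h1]
    ring
  have hlow : c * P ≤ P + η / 6 * D := by
    rcases le_total 0 η with h | h
    · nlinarith [mul_nonneg h hD0]
    · nlinarith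
  have hup : 2 * c * ∑ k ∈ Finset.range n, e (k + 1) * g k
      ≤ c ^ 2 * P + ∑ k ∈ Finset.range n, g k ^ 2 := by
    rw [hP, Finset.mul_sum, Finset.mul_sum, ← Finset.sum_add_distrib]
    exact Finset.sum_le_sum fun k _ => by nlinarith [sq_nonneg (c * e (k + 1) - g k)]
  rw [hsum] at hup
  nlinarith

/-! ### Control of the unknown common end value. -/

theorem nodalQuad_sub (N : ℕ) (d D : ℕ → ℝ) :
    nodalQuad N (fun i => d i - D i) = nodalQuad N d - nodalQuad N D := by
  have : ∀ j, (d j - D j + (d (j + 1) - D (j + 1))) / 2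
      = (d j + d (j + 1)) / 2 - (D j + D (j + 1)) / 2 := fun j => by ring
  simp only [nodalQuad, this, Finset.sum_sub_distrib]
  ring

theorem nodalQuad_const {N : ℕ} (hN : 2 ≤ N) (c : ℝ) : nodalQuad N (fun _ => c) = c := by
  have := natCast_mul_meshSize hN
  simp only [nodalQuad, Finset.sum_const, Finset.card_range, nsmul_eq_mul]
  linear_combination c * this

/-- Subtracting `κ = e 0` gives the coercive problem with zero end values. The quadrature reproduces
constants, so `κ` differs from `nodalQuad` of `e` only by the quadrature of `e - κ`, which the
energy bound controls. -/
theorem sum_sq_le_of_shifted {η c : ℝ} (hc : 0 < c) (hc1 : c ≤ 1) (hcη : c ≤ 1 + 2 * η / 3)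
    {n : ℕ} (hn : 1 ≤ n) {e g : ℕ → ℝ} (hN : e (n + 1) = e 0)
    (he : ∀ k < n, e (k + 1) - η / 6 * (e k - 2 * e (k + 1) + e (k + 2)) = e 0 + g k) :
    ∑ i ∈ Finset.range (n + 2), e i ^ 2 ≤ 18 / c ^ 2 * ∑ k ∈ Finset.range n, g k ^ 2
      + 8 * (n + 1) * nodalQuad (n + 1) e ^ 2 := by
  have hmesh := natCast_mul_meshSize (N := n + 1) (by omega)
  have hpos := meshSize_pos (N := n + 1) (by omega)
  have hn' : (1 : ℝ) ≤ n := by exact_mod_cast hn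
  push_cast at hmesh
  set h := meshSize (n + 1) with hh
  set κ := e 0 with hκ
  set P := ∑ k ∈ Finset.range n, (e (k + 1) - κ) ^ 2 with hP
  set s := nodalQuad (n + 1) e with hs
  have hP0 : 0 ≤ P := Finset.sum_nonneg fun _ _ => sq_nonneg _
  have henergy := sum_sq_le_of_second_diff hc hc1 hcη (n := n) (e := fun i => e i - κ) (g := g)
    (by simp [hκ]) (by simp [hN]) (fun k hk => by linarith [he k hk])
  have hPG : P ≤ 1 / c ^ 2 * ∑ k ∈ Finset.range n, g k ^ 2 := by
    rw [one_div, inv_mul_eq_div, le_div_iff₀ (by positivity)]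
    linarith
  have hsκ : s - κ = h * ∑ k ∈ Finset.range n, (e (k + 1) - κ)
      + h / 6 * ((e 1 - κ) + (e n - κ)) := by
    have h1 := nodalQuad_sub (n + 1) e (fun _ => κ)
    rw [nodalQuad_const (by omega)] at h1
    rw [hs, ← h1, nodalQuad, ← Finset.sum_div, Finset.sum_add_distrib,
      Finset.sum_range_succ' (fun i => e i - κ), Finset.sum_range_succ (fun k => e (k + 1) - κ),
      ← hκ, hN, Nat.add_sub_cancel]
    ring
  have hCS : (∑ k ∈ Finset.range n, (e (k + 1) - κ)) ^ 2 ≤ n * P := by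
    simpa using sq_sum_le_card_mul_sum_sq (s := Finset.range n) (f := fun k => e (k + 1) - κ)
  have h1P : (e 1 - κ) ^ 2 ≤ P :=
    Finset.single_le_sum (f := fun k => (e (k + 1) - κ) ^ 2) (fun _ _ => sq_nonneg _)
      (Finset.mem_range.2 (by omega : 0 < n))
  have hnP : (e n - κ) ^ 2 ≤ P := by
    have := Finset.single_le_sum (f := fun k => (e (k + 1) - κ) ^ 2) (fun _ _ => sq_nonneg _)
      (Finset.mem_range.2 (by omega : n - 1 < n))
    simpa [Nat.sub_add_cancel hn] using this
  have hsκ2 : (s - κ) ^ 2 ≤ 2 * h * P := by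
    have a1 : (s - κ) ^ 2 ≤ 2 * (h ^ 2 * (n * P)) + 2 * (h ^ 2 / 36 * (4 * P)) := by
      have b1 : ((e 1 - κ) + (e n - κ)) ^ 2 ≤ 4 * P := by
        nlinarith [sq_nonneg ((e 1 - κ) - (e n - κ))]
      have b2 := mul_le_mul_of_nonneg_left hCS (sq_nonneg h)
      have b3 := mul_le_mul_of_nonneg_left b1 (by positivity : 0 ≤ h ^ 2 / 36)
      rw [hsκ]
      nlinarith [sq_nonneg (h * ∑ k ∈ Finset.range n, (e (k + 1) - κ)
        - h / 6 * ((e 1 - κ) + (e n - κ)))]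
    have a2 : 2 * (h ^ 2 * (n * P)) + 2 * (h ^ 2 / 36 * (4 * P))
        = 2 * h * P - 16 / 9 * (h ^ 2 * P) := by
      linear_combination 2 * h * P * hmesh
    nlinarith [mul_nonneg (sq_nonneg h) hP0]
  have hκ2 : κ ^ 2 ≤ 2 * s ^ 2 + 4 * h * P := by nlinarith [sq_nonneg (2 * s - κ)]
  have hsum : ∑ i ∈ Finset.range (n + 2), e i ^ 2 ≤ 2 * P + 2 * (n + 2) * κ ^ 2 := by
    have a1 : ∑ i ∈ Finset.range (n + 2), e i ^ 2
        ≤ ∑ i ∈ Finset.range (n + 2), (2 * (e i - κ) ^ 2 + 2 * κ ^ 2) :=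
      Finset.sum_le_sum fun i _ => by nlinarith [sq_nonneg (e i - 2 * κ)]
    have a2 : ∑ i ∈ Finset.range (n + 2), (e i - κ) ^ 2 = P := by
      rw [Finset.sum_range_succ, Finset.sum_range_succ', ← hP, hN, ← hκ]
      ring
    rw [Finset.sum_add_distrib, ← Finset.mul_sum, a2] at a1
    simp only [Finset.sum_const, Finset.card_range, nsmul_eq_mul] at a1
    push_cast at a1
    linarith
  -- With `n + 2 ≤ 2 * (n + 1)` and `(n + 1) * h = 1`, the bound on `κ²` contributes `16 * P`,
  -- whence the constant `18`.
  have hfin : 2 * P + 2 * (n + 2) * κ ^ 2 ≤ 18 * P + 8 * (n + 1) * s ^ 2 := by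
    have a1 : (2 * (n + 2) : ℝ) * κ ^ 2 ≤ (4 * (n + 1) : ℝ) * (2 * s ^ 2 + 4 * h * P) := by
      refine mul_le_mul (by linarith) hκ2 (sq_nonneg _) (by positivity)
    have a2 : (4 * (n + 1) : ℝ) * (2 * s ^ 2 + 4 * h * P) = 8 * (n + 1) * s ^ 2 + 16 * P := by
      linear_combination 16 * P * hmesh
    linarith
  calc _ ≤ 18 * P + 8 * (n + 1) * s ^ 2 := hsum.trans hfin
    _ ≤ _ := by
      have : 18 / c ^ 2 = 18 * (1 / c ^ 2) := by ring
      rw [this, mul_assoc]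
      linarith

/-- Nodal derivatives with prescribed flux differences are close to any sequence of nodal values
with the same differences, up to the consistency errors. -/
theorem sum_sq_sub_le_of_flux {η c : ℝ} (hc : 0 < c) (hc1 : c ≤ 1) (hcη : c ≤ 1 + 2 * η / 3)
    {N : ℕ} (hN : 2 ≤ N) {d D : ℕ → ℝ} (hd : nodalQuad N d = 0)
    (hfl : ∀ j < N, flux η N d (j + 1) - flux η N d j = D j - D (j + 1)) :
    ∑ i ∈ Finset.range (N + 1), (d i - D i) ^ 2
      ≤ 18 / c ^ 2 * ∑ k ∈ Finset.range (N - 1), (η / 6 * (D k - 2 * D (k + 1) + D (k + 2))) ^ 2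
        + 8 * N * nodalQuad N D ^ 2 := by
  -- Equal differences make `flux + D` constant. Since the flux is `-d` at both end nodes, the
  -- errors there coincide, and the interior nodes give the shifted difference equation.
  have hconst : ∀ i ≤ N, flux η N d i + D i = -(d 0 - D 0) := by
    intro i
    induction i with
    | zero =>
      intro _
      rw [flux, if_pos (Or.inl rfl)]
      ring
    | succ i ih =>
      intro hi
      linarith [ih (by omega), hfl i (by omega)]
  have hNN := hconst N le_rfl
  rw [flux, if_pos (Or.inr rfl)] at hNN
  obtain ⟨n, rfl⟩ : ∃ n, N = n + 1 := ⟨N - 1, by omega⟩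
  have key := sum_sq_le_of_shifted hc hc1 hcη (n := n) (by omega) (e := fun i => d i - D i)
    (g := fun k => η / 6 * (D k - 2 * D (k + 1) + D (k + 2))) (by linarith)
    (fun k hk => by
      have := hconst (k + 1) (by omega)
      rw [flux, if_neg (by omega), Nat.add_sub_cancel] at this
      linarith)
  rw [nodalQuad_sub, hd, zero_sub, neg_sq] at key
  simpa using key

theorem eq_zero_of_flux_eq {η : ℝ} (hη : -(3 / 2) < η) {N : ℕ} (hN : 2 ≤ N) {d : ℕ → ℝ}
    (hd : nodalQuad N d = 0) (hfl : ∀ j < N, flux η N d (j + 1) = flux η N d j) :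
    ∀ i ≤ N, d i = 0 := by
  have key := sum_sq_sub_le_of_flux (η := η) (c := min 1 (1 + 2 * η / 3))
    (lt_min one_pos (by linarith)) (min_le_left _ _) (min_le_right _ _) hN (D := fun _ => 0) hd
    (fun j hj => by rw [hfl j hj]; ring)
  rw [nodalQuad_const hN] at key
  simp only [sub_zero, mul_zero, add_zero, ne_eq, OfNat.ofNat_ne_zero, not_false_eq_true, zero_pow,
    Finset.sum_const_zero] at key
  intro i hi
  have := (Finset.sum_eq_zero_iff_of_nonneg (fun i _ => sq_nonneg (d i))).1
    (le_antisymm key (Finset.sum_nonneg fun _ _ => sq_nonneg _)) i (Finset.mem_range.2 (by omega))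
  exact pow_eq_zero_iff two_ne_zero |>.1 this

/-! ### Solvability of the discrete problem. -/

theorem flux_sub (η : ℝ) (N : ℕ) (d D : ℕ → ℝ) (i : ℕ) :
    flux η N (fun i => d i - D i) i = flux η N d i - flux η N D i := by
  unfold flux
  split_ifs <;> ring

/-- The quadrature condition and the `N` flux balances form a square linear system for the `N + 1`
nodal derivatives, so injectivity suffices. -/
theorem exists_flux_eq {η : ℝ} (hη : -(3 / 2) < η) {N : ℕ} (hN : 2 ≤ N) (F : Fin N → ℝ) :
    ∃ d : ℕ → ℝ, nodalQuad N d = 0 ∧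
      ∀ j : Fin N, flux η N d (j + 1) - flux η N d j = F j := by
  -- `Fin.ofNat` wraps indices modulo `N + 1`, but only the indices `0, …, N` are read.
  let T : (Fin (N + 1) → ℝ) →ₗ[ℝ] ℝ × (Fin N → ℝ) :=
    { toFun := fun d => (nodalQuad N (fun i => d (Fin.ofNat (N + 1) i)),
        fun j => flux η N (fun i => d (Fin.ofNat (N + 1) i)) (j + 1)
          - flux η N (fun i => d (Fin.ofNat (N + 1) i)) j)
      map_add' := by
        intro x y
        refine Prod.ext ?_ (funext fun j => ?_)
        · have : ∀ p q r s : ℝ, (p + q + (r + s)) / 2 = (p + r) / 2 + (q + s) / 2 :=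
            fun p q r s => by ring
          simp only [nodalQuad, Pi.add_apply, this, Finset.sum_add_distrib, Prod.fst_add]
          ring
        · simp only [flux, Pi.add_apply, Prod.snd_add]
          split_ifs <;> ring
      map_smul' := by
        intro r x
        refine Prod.ext ?_ (funext fun j => ?_)
        · have : ∀ p q : ℝ, (r * p + r * q) / 2 = r * ((p + q) / 2) := fun p q => by ring
          simp only [nodalQuad, Pi.smul_apply, smul_eq_mul, this, ← Finset.mul_sum, Prod.smul_fst,
            RingHom.id_apply]
          ring
        · simp only [flux, Pi.smul_apply, smul_eq_mul, Prod.smul_snd, RingHom.id_apply]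
          split_ifs <;> ring }
  have hinj : Function.Injective T := by
    rw [injective_iff_map_eq_zero]
    intro d hd
    have h1 : nodalQuad N (fun i => d (Fin.ofNat (N + 1) i)) = 0 := congrArg Prod.fst hd
    have h2 := fun j : Fin N => congrFun (congrArg Prod.snd hd) j
    have h3 := eq_zero_of_flux_eq hη hN h1 fun j hj => sub_eq_zero.1 (h2 ⟨j, hj⟩)
    funext i
    have := h3 i (by omega)
    simpa using this
  have hsurj : Function.Surjective T :=
    (LinearMap.injective_iff_surjective_of_finrank_eq_finrank (by simp; ring)).1 hinj
  obtain ⟨d, hd⟩ := hsurj (0, F)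
  exact ⟨fun i => d (Fin.ofNat (N + 1) i), congrArg Prod.fst hd,
    fun j => congrFun (congrArg Prod.snd hd) j⟩

/-- Existence and uniqueness of the discrete solution. -/
theorem existsUnique_isDiscreteSolution {η : ℝ} (hη : -(3 / 2) < η) (f : ℝ → ℝ) {N : ℕ}
    (hN : 2 ≤ N) : ∃! p : Fin N → ℝ[X], IsDiscreteSolution η f N p := by
  obtain ⟨d, h1, h2⟩ := exists_flux_eq hη hN fun j : Fin N =>
    ∫ x in node N j..node N (j + 1), f x
  refine ⟨fun j : Fin N => recPoly N (cellAvg N d) d j, (isDiscreteSolution_iff hN).2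
    ⟨cellAvg N d, d, isStencil_cellAvg hN h1, fun _ => rfl, fun j hj => h2 ⟨j, hj⟩⟩, ?_⟩
  intro q hq
  obtain ⟨b, D, hst, hqD, hfl⟩ := (isDiscreteSolution_iff hN).1 hq
  have h0 := eq_zero_of_flux_eq hη hN (d := fun i => D i - d i)
    (by rw [nodalQuad_sub, hst.nodalQuad_eq_zero hN, h1, sub_zero]) (fun j hj => by
      rw [flux_sub, flux_sub]
      linarith [hfl j hj, h2 ⟨j, hj⟩])
  have hDd : ∀ i ≤ N, D i = d i := fun i hi => sub_eq_zero.1 (h0 i hi)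
  funext j
  have hb : b j = cellAvg N d j := by
    rw [hst.eq_cellAvg j j.isLt, cellAvg, cellAvg, hDd 0 (by omega), hDd 1 (by omega)]
    congr 2
    exact Finset.sum_congr rfl fun k hk => hDd _ (by have := Finset.mem_range.1 hk; omega)
  rw [hqD, recPoly, recPoly, hb, hDd j (by omega), hDd (j + 1) (by omega)]

/-! ### Bounding the norms by cellwise bounds -/

theorem jump_sq {N : ℕ} (w : Broken N) (i : Fin (N + 1)) :
    jump w i ^ 2 = (leftTrace w i - rightTrace w i) ^ 2 := by
  rw [← faceNormal_mul_jump]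
  linear_combination -jump w i ^ 2 * faceNormal_sq i

theorem intervalIntegral_sq_cell_le {N : ℕ} (hN : 2 ≤ N) {j : ℕ} {F : ℝ → ℝ} {b : ℝ}
    (hF : ∀ x ∈ Icc (node N j) (node N (j + 1)), F x ^ 2 ≤ b) :
    ∫ x in node N j..node N (j + 1), F x ^ 2 ≤ meshSize N * b := by
  have hlt := node_lt_succ hN j
  have := intervalIntegral.norm_integral_le_of_norm_le_const (a := node N j)
    (b := node N (j + 1)) (f := fun x => F x ^ 2) (C := b) (fun x hx => by
      rw [uIoc_of_le hlt.le] at hx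
      rw [Real.norm_of_nonneg (sq_nonneg _)]
      exact hF x (Ioc_subset_Icc_self hx))
  rw [node_succ, add_sub_cancel_left, abs_of_pos (meshSize_pos hN), mul_comm, ← node_succ] at this
  exact (le_abs_self _).trans this

/-- A broken function whose broken gradient and scaled jumps are controlled by `r`. -/
structure IsControlled {N : ℕ} (w : Broken N) (r : ℕ → ℝ) : Prop where
  differentiableOn : ∀ j, DifferentiableOn ℝ (w j) (cell N j)
  abs_grad_le : ∀ j, ∀ x ∈ cell N j, |grad w j x| ≤ r j
  abs_jump_le : ∀ i : Fin N,
    |leftTrace w i.castSucc - rightTrace w i.castSucc| ≤ meshSize N * r i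
  last : leftTrace w (Fin.last N) = 0

namespace IsControlled

variable {N : ℕ} {w : Broken N} {r : ℕ → ℝ}

theorem nonneg (hN : 2 ≤ N) (h : IsControlled w r) (j : Fin N) : 0 ≤ r j :=
  (abs_nonneg _).trans (h.abs_grad_le j _ (left_mem_cell hN j))

/-- The face `x_i` with `i < N` is charged to the cell on its right and the last face contributes
nothing. The gradient, the jump and the two end point derivatives account for the factor `4`. -/
theorem sipStarNorm_le (hN : 2 ≤ N) (h : IsControlled w r) :
    sipStarNorm w ≤ Real.sqrt (4 * meshSize N * ∑ j ∈ Finset.range N, r j ^ 2) := by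
  have hpos := meshSize_pos hN
  have hgrad : ∀ j, ∀ x ∈ cell N j, grad w j x ^ 2 ≤ r j ^ 2 := fun j x hx =>
    sq_le_sq' (neg_le_of_abs_le (h.abs_grad_le j x hx)) (le_of_abs_le (h.abs_grad_le j x hx))
  refine Real.sqrt_le_sqrt ?_
  rw [← Fin.sum_univ_eq_sum_range (fun j => r j ^ 2), sipNormSq, Fin.sum_univ_castSucc]
  have e1 : ∑ j : Fin N, ∫ x in node N j..node N (j + 1), grad w j x ^ 2
      ≤ ∑ j : Fin N, meshSize N * r j ^ 2 :=
    Finset.sum_le_sum fun j _ => intervalIntegral_sq_cell_le hN (hgrad j)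
  have e2 : ∑ i : Fin N, 1 / meshSize N * jump w i.castSucc ^ 2
      ≤ ∑ j : Fin N, meshSize N * r j ^ 2 := by
    refine Finset.sum_le_sum fun i _ => ?_
    have h1 : jump w i.castSucc ^ 2 ≤ (meshSize N * r i) ^ 2 := by
      rw [jump_sq]
      exact sq_le_sq' (neg_le_of_abs_le (h.abs_jump_le i)) (le_of_abs_le (h.abs_jump_le i))
    calc 1 / meshSize N * jump w i.castSucc ^ 2
        ≤ 1 / meshSize N * (meshSize N * r i) ^ 2 := by gcongr
      _ = meshSize N * r i ^ 2 := by field_simp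
  have e3 : ∑ j : Fin N, meshSize N *
      ((grad w j (node N j)) ^ 2 + (grad w j (node N (j + 1))) ^ 2)
      ≤ 2 * ∑ j : Fin N, meshSize N * r j ^ 2 := by
    rw [Finset.mul_sum]
    refine Finset.sum_le_sum fun j _ => ?_
    nlinarith [hgrad j _ (left_mem_cell hN j), hgrad j _ (right_mem_cell hN j)]
  have e4 : jump w (Fin.last N) ^ 2 = 0 := by
    rw [jump_sq, h.last, rightTrace_last]
    ring
  have es : ∑ j : Fin N, meshSize N * r j ^ 2 = meshSize N * ∑ j : Fin N, r j ^ 2 :=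
    (Finset.mul_sum _ _ _).symm
  rw [e4]
  linarith

theorem abs_sub_le (hN : 2 ≤ N) (h : IsControlled w r) (j : Fin N) {x : ℝ} (hx : x ∈ cell N j) :
    |w j x - w j (node N j)| ≤ meshSize N * r j := by
  have h1 := (convex_Icc (node N j) (node N (j + 1))).norm_image_sub_le_of_norm_derivWithin_le
    (h.differentiableOn j) (fun y hy => h.abs_grad_le j y hy) (left_mem_cell hN j) hx
  rw [Real.norm_eq_abs, Real.norm_eq_abs, abs_of_nonneg (sub_nonneg.2 hx.1), mul_comm] at h1
  have h2 : x - node N j ≤ meshSize N := by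
    have := hx.2
    rw [node_succ] at this
    linarith
  exact h1.trans (mul_le_mul_of_nonneg_right h2 (h.nonneg hN j))

/-- Walk from the left boundary: each cell costs `h * r k` for the jump at its left face and `h * r
k` for the variation inside. At `x_0` the jump is the trace itself, which starts the induction. -/
theorem abs_le_sum (hN : 2 ≤ N) (h : IsControlled w r) (n : ℕ) (hn : n < N) :
    ∀ x ∈ cell N ⟨n, hn⟩, |w ⟨n, hn⟩ x| ≤ ∑ k ∈ Finset.range (n + 1), 2 * meshSize N * r k := by
  induction n with
  | zero =>
    intro x hx
    have h1 := h.abs_sub_le hN ⟨0, hn⟩ hx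
    have h2 := h.abs_jump_le ⟨0, hn⟩
    rw [rightTrace_castSucc] at h2
    have h3 : leftTrace w (Fin.castSucc ⟨0, hn⟩) = 0 := by simp [leftTrace]
    rw [h3, zero_sub, abs_neg] at h2
    have := abs_sub_abs_le_abs_sub (w ⟨0, hn⟩ x) (w ⟨0, hn⟩ (node N 0))
    simp only [Finset.sum_range_succ, Finset.sum_range_zero] at *
    linarith
  | succ n ih =>
    intro x hx
    have h0 := ih (by omega) _ (right_mem_cell hN ⟨n, by omega⟩)
    have h1 := h.abs_sub_le hN ⟨n + 1, hn⟩ hx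
    have h2 := h.abs_jump_le ⟨n + 1, hn⟩
    rw [rightTrace_castSucc] at h2
    have h3 : leftTrace w (Fin.castSucc ⟨n + 1, hn⟩) = w ⟨n, by omega⟩ (node N (n + 1)) :=
      leftTrace_succ w ⟨n, by omega⟩
    rw [h3] at h2
    have a1 := abs_sub_abs_le_abs_sub (w ⟨n + 1, hn⟩ x) (w ⟨n + 1, hn⟩ (node N (n + 1)))
    have a2 := abs_sub_abs_le_abs_sub (w ⟨n + 1, hn⟩ (node N (n + 1)))
      (w ⟨n, by omega⟩ (node N (n + 1)))
    rw [abs_sub_comm (w ⟨n + 1, hn⟩ (node N (n + 1)))] at a2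
    rw [Finset.sum_range_succ]
    simp only at *
    linarith

/-- The broken Poincaré inequality. -/
theorem l2Norm_le (hN : 2 ≤ N) (h : IsControlled w r) :
    l2Norm w ≤ Real.sqrt (4 * meshSize N * ∑ j ∈ Finset.range N, r j ^ 2) := by
  have hpos := meshSize_pos hN
  have hmul := natCast_mul_meshSize hN
  refine Real.sqrt_le_sqrt ?_
  set R := ∑ j ∈ Finset.range N, r j ^ 2 with hR
  have hr : ∀ k ∈ Finset.range N, 0 ≤ r k := fun k hk => h.nonneg hN ⟨k, Finset.mem_range.1 hk⟩
  have hCS : (∑ j ∈ Finset.range N, r j) ^ 2 ≤ N * R := by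
    simpa using sq_sum_le_card_mul_sum_sq (s := Finset.range N) (f := r)
  have hw : ∀ j : Fin N, ∀ x ∈ cell N j, w j x ^ 2 ≤ 4 * meshSize N * R := by
    intro j x hx
    have h1 : |w j x| ≤ 2 * meshSize N * ∑ k ∈ Finset.range N, r k := by
      refine (h.abs_le_sum hN j j.isLt x hx).trans ?_
      rw [← Finset.mul_sum]
      refine mul_le_mul_of_nonneg_left ?_ (by positivity)
      exact Finset.sum_le_sum_of_subset_of_nonneg (Finset.range_mono j.isLt)
        fun k hk _ => hr k hk
    calc w j x ^ 2 = |w j x| ^ 2 := (sq_abs _).symm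
      _ ≤ (2 * meshSize N * ∑ k ∈ Finset.range N, r k) ^ 2 := by gcongr
      _ = 4 * meshSize N ^ 2 * (∑ k ∈ Finset.range N, r k) ^ 2 := by ring
      _ ≤ 4 * meshSize N ^ 2 * (N * R) := by gcongr
      _ = 4 * meshSize N * R := by linear_combination 4 * meshSize N * R * hmul
  calc _ ≤ ∑ j : Fin N, meshSize N * (4 * meshSize N * R) :=
        Finset.sum_le_sum fun j _ => intervalIntegral_sq_cell_le hN (hw j)
    _ = 4 * meshSize N * R := by
        simp only [Finset.sum_const, Finset.card_univ, Fintype.card_fin, nsmul_eq_mul]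
        linear_combination 4 * meshSize N * R * hmul

end IsControlled

/-! ### Consistency -/

theorem abs_sub_le_of_hasDerivAt {F F' : ℝ → ℝ} {s t M : ℝ} (hF : ∀ x, HasDerivAt F (F' x) x)
    (hM : ∀ x ∈ Icc s t, |F' x| ≤ M) {x y : ℝ} (hx : x ∈ Icc s t) (hy : y ∈ Icc s t) :
    |F y - F x| ≤ M * |y - x| :=
  (convex_Icc s t).norm_image_sub_le_of_norm_hasDerivWithin_le
    (fun x _ => (hF x).hasDerivWithinAt) hM hx hy

theorem node_nonneg {N : ℕ} (hN : 2 ≤ N) (j : ℕ) : 0 ≤ node N j :=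
  mul_nonneg (Nat.cast_nonneg _) (meshSize_pos hN).le

theorem node_le_one {N : ℕ} (hN : 2 ≤ N) {j : ℕ} (hj : j ≤ N) : node N j ≤ 1 := by
  rw [← node_self hN]
  exact mul_le_mul_of_nonneg_right (by exact_mod_cast hj) (meshSize_pos hN).le

/-- The regularity of the exact solution that enters the error estimate. -/
structure IsRegular (U U₁ U₂ Γ : ℝ → ℝ) : Prop where
  hasDerivAt : ∀ x, HasDerivAt U (U₁ x) x
  hasDerivAt_deriv : ∀ x, HasDerivAt U₁ (U₂ x) x
  sq_sub_le : ∀ x y, 0 ≤ x → x ≤ y → y ≤ 1 → (U₂ y - U₂ x) ^ 2 ≤ (y - x) * (Γ y - Γ x)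
  mono : ∀ x y, 0 ≤ x → x ≤ y → y ≤ 1 → Γ x ≤ Γ y

namespace IsRegular

variable {U U₁ U₂ Γ : ℝ → ℝ} {N : ℕ}

/-- The oscillation bound of `U₂` on the `j`-th cell. -/
noncomputable def osc (N : ℕ) (Γ : ℝ → ℝ) (j : ℕ) : ℝ :=
  Real.sqrt (meshSize N * (Γ (node N (j + 1)) - Γ (node N j)))

theorem incr_nonneg (h : IsRegular U U₁ U₂ Γ) (hN : 2 ≤ N) {j : ℕ} (hj : j < N) :
    0 ≤ Γ (node N (j + 1)) - Γ (node N j) :=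
  sub_nonneg.2 (h.mono _ _ (node_nonneg hN j) (node_lt_succ hN j).le (node_le_one hN hj))

theorem sq_osc (h : IsRegular U U₁ U₂ Γ) (hN : 2 ≤ N) {j : ℕ} (hj : j < N) :
    osc N Γ j ^ 2 = meshSize N * (Γ (node N (j + 1)) - Γ (node N j)) :=
  Real.sq_sqrt (mul_nonneg (meshSize_pos hN).le (h.incr_nonneg hN hj))

theorem sum_sq_osc (h : IsRegular U U₁ U₂ Γ) (hN : 2 ≤ N) :
    ∑ j ∈ Finset.range N, osc N Γ j ^ 2 = meshSize N * (Γ 1 - Γ 0) := by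
  rw [Finset.sum_congr rfl fun j hj => h.sq_osc hN (Finset.mem_range.1 hj), ← Finset.mul_sum,
    Finset.sum_range_sub (fun j => Γ (node N j)), node_self hN, node_zero]

theorem abs_sub_le_osc (h : IsRegular U U₁ U₂ Γ) (hN : 2 ≤ N) {j : ℕ} (hj : j < N) {x y : ℝ}
    (hx : x ∈ Icc (node N j) (node N (j + 1))) (hy : y ∈ Icc (node N j) (node N (j + 1))) :
    |U₂ x - U₂ y| ≤ osc N Γ j := by
  wlog hxy : y ≤ x generalizing x y
  · rw [abs_sub_comm]
    exact this hy hx (not_le.1 hxy).le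
  have h0 := node_nonneg hN j
  have h1 := node_le_one hN hj
  refine Real.abs_le_sqrt ((h.sq_sub_le y x (h0.trans hy.1) hxy (hx.2.trans h1)).trans ?_)
  have a1 := h.mono (node N j) y h0 hy.1 (hy.2.trans h1)
  have a2 := h.mono x (node N (j + 1)) (h0.trans hx.1) hx.2 h1
  have a3 := h.mono y x (h0.trans hy.1) hxy (hx.2.trans h1)
  have a4 := node_succ N j
  exact mul_le_mul (by linarith [hx.2, hy.1]) (by linarith) (by linarith) (meshSize_pos hN).le

/-- The slope is taken at an arbitrary point `y` of the cell, so that two adjacent cells can share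
the slope at their common node. -/
theorem abs_taylor_le (h : IsRegular U U₁ U₂ Γ) (hN : 2 ≤ N) {j : ℕ} (hj : j < N) {x y z : ℝ}
    (hx : x ∈ Icc (node N j) (node N (j + 1))) (hy : y ∈ Icc (node N j) (node N (j + 1)))
    (hz : z ∈ Icc (node N j) (node N (j + 1))) :
    |U₁ z - U₁ x - (z - x) * U₂ y| ≤ osc N Γ j * meshSize N := by
  have h1 := abs_sub_le_of_hasDerivAt (F := fun t => U₁ t - t * U₂ y) (F' := fun t => U₂ t - U₂ y)
    (fun t => by
      convert! (h.hasDerivAt_deriv t).sub ((hasDerivAt_id t).mul_const (U₂ y)) using 1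
      ring) (fun t ht => h.abs_sub_le_osc hN hj ht hy) hx hz
  have h2 : |z - x| ≤ meshSize N := by
    have a4 := node_succ N j
    rw [abs_le]
    constructor <;> linarith [hx.1, hx.2, hz.1, hz.2]
  have h3 := h1.trans (mul_le_mul_of_nonneg_left h2 (Real.sqrt_nonneg _))
  convert! h3 using 2
  ring

/-- Expanding on both sides with the slope `U₂` at the middle node cancels the linear terms. -/
theorem sq_second_diff_le (h : IsRegular U U₁ U₂ Γ) (hN : 2 ≤ N) {k : ℕ} (hk : k + 1 < N) :
    (U₁ (node N k) - 2 * U₁ (node N (k + 1)) + U₁ (node N (k + 2))) ^ 2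
      ≤ 2 * meshSize N ^ 2 * (osc N Γ k ^ 2 + osc N Γ (k + 1) ^ 2) := by
  have hl := node_lt_succ hN k
  have hr := node_lt_succ hN (k + 1)
  have h1 := h.abs_taylor_le hN (j := k) (by omega) (left_mem_Icc.2 hl.le) (right_mem_Icc.2 hl.le)
    (right_mem_Icc.2 hl.le)
  have h2 := h.abs_taylor_le hN (j := k + 1) hk (left_mem_Icc.2 hr.le) (left_mem_Icc.2 hr.le)
    (right_mem_Icc.2 hr.le)
  rw [show node N (k + 1) - node N k = meshSize N by rw [node_succ]; ring] at h1
  rw [show node N (k + 1 + 1) - node N (k + 1) = meshSize N by rw [node_succ N (k + 1)]; ring] at h2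
  have s1 := sq_le_sq' (neg_le_of_abs_le h1) (le_of_abs_le h1)
  have s2 := sq_le_sq' (neg_le_of_abs_le h2) (le_of_abs_le h2)
  nlinarith [sq_nonneg ((U₁ (node N (k + 1)) - U₁ (node N k) - meshSize N * U₂ (node N (k + 1)))
    + (U₁ (node N (k + 1 + 1)) - U₁ (node N (k + 1)) - meshSize N * U₂ (node N (k + 1))))]

theorem sum_sq_second_diff_le (h : IsRegular U U₁ U₂ Γ) (hN : 2 ≤ N) :
    ∑ k ∈ Finset.range (N - 1),
      (U₁ (node N k) - 2 * U₁ (node N (k + 1)) + U₁ (node N (k + 2))) ^ 2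
      ≤ 4 * meshSize N ^ 3 * (Γ 1 - Γ 0) := by
  have h1 : ∑ k ∈ Finset.range (N - 1),
      (U₁ (node N k) - 2 * U₁ (node N (k + 1)) + U₁ (node N (k + 2))) ^ 2
      ≤ ∑ k ∈ Finset.range (N - 1), 2 * meshSize N ^ 2 * (osc N Γ k ^ 2 + osc N Γ (k + 1) ^ 2) :=
    Finset.sum_le_sum fun k hk => h.sq_second_diff_le hN (by
      have := Finset.mem_range.1 hk
      omega)
  have h2 : ∑ k ∈ Finset.range (N - 1), osc N Γ k ^ 2 ≤ meshSize N * (Γ 1 - Γ 0) := by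
    rw [← h.sum_sq_osc hN]
    exact Finset.sum_le_sum_of_subset_of_nonneg (Finset.range_mono (by omega))
      fun _ _ _ => sq_nonneg _
  have h3 : ∑ k ∈ Finset.range (N - 1), osc N Γ (k + 1) ^ 2 ≤ meshSize N * (Γ 1 - Γ 0) := by
    obtain ⟨n, rfl⟩ : ∃ n, N = n + 1 := ⟨N - 1, by omega⟩
    rw [← h.sum_sq_osc hN, Finset.sum_range_succ', Nat.add_sub_cancel]
    linarith [sq_nonneg (osc (n + 1) Γ 0)]
  rw [← Finset.mul_sum, Finset.sum_add_distrib] at h1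
  have h4 := mul_le_mul_of_nonneg_left (add_le_add h2 h3)
    (by positivity : 0 ≤ 2 * meshSize N ^ 2)
  linarith

theorem abs_sub_interp_le (h : IsRegular U U₁ U₂ Γ) (hN : 2 ≤ N) {j : ℕ} (hj : j < N) {x : ℝ}
    (hx : x ∈ Icc (node N j) (node N (j + 1))) :
    |U₁ x - (U₁ (node N j) + (x - node N j) / meshSize N
      * (U₁ (node N (j + 1)) - U₁ (node N j)))| ≤ 2 * (osc N Γ j * meshSize N) := by
  have hpos := meshSize_pos hN
  have hl := node_lt_succ hN j
  have h1 := h.abs_taylor_le hN hj (left_mem_Icc.2 hl.le) (left_mem_Icc.2 hl.le) hx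
  have h2 := h.abs_taylor_le hN hj (left_mem_Icc.2 hl.le) (left_mem_Icc.2 hl.le)
    (right_mem_Icc.2 hl.le)
  have e : node N (j + 1) - node N j = meshSize N := by rw [node_succ]; ring
  rw [e] at h2
  set θ := (x - node N j) / meshSize N with hθ
  have hθ0 : 0 ≤ θ := div_nonneg (sub_nonneg.2 hx.1) hpos.le
  have hθ1 : θ ≤ 1 := (div_le_one hpos).2 (by linarith [hx.2])
  have hxθ : x - node N j = θ * meshSize N := by rw [hθ]; field_simp
  rw [hxθ] at h1
  rw [abs_le] at *
  constructor <;> nlinarith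

/-- The trapezoidal error is the integral over the cell of the linear interpolation error of `U₁`;
the mean value inequality is applied to a primitive of the latter. -/
theorem abs_trapezoid_le (h : IsRegular U U₁ U₂ Γ) (hN : 2 ≤ N) {j : ℕ} (hj : j < N) :
    |U (node N (j + 1)) - U (node N j)
      - meshSize N * ((U₁ (node N j) + U₁ (node N (j + 1))) / 2)|
      ≤ 2 * meshSize N ^ 2 * osc N Γ j := by
  have hpos := meshSize_pos hN
  have hl := node_lt_succ hN j
  have e : node N (j + 1) - node N j = meshSize N := by rw [node_succ]; ring
  have h1 := abs_sub_le_of_hasDerivAt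
    (F := fun t => U t - (t * U₁ (node N j) + (t - node N j) ^ 2 / (2 * meshSize N)
      * (U₁ (node N (j + 1)) - U₁ (node N j))))
    (F' := fun x => U₁ x - (U₁ (node N j) + (x - node N j) / meshSize N
      * (U₁ (node N (j + 1)) - U₁ (node N j))))
    (fun t => by
      convert! (h.hasDerivAt t).sub (((hasDerivAt_id t).mul_const (U₁ (node N j))).add
        (((((hasDerivAt_id t).sub_const (node N j)).pow 2).div_const (2 * meshSize N)).mul_const
          (U₁ (node N (j + 1)) - U₁ (node N j)))) using 1
      simp
      field_simp
      simp) (fun t ht => h.abs_sub_interp_le hN hj ht) (left_mem_Icc.2 hl.le)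
      (right_mem_Icc.2 hl.le)
  rw [e, abs_of_pos hpos] at h1
  calc _ = _ := by
        congr 1
        simp only [sub_self]
        rw [show node N (j + 1) = node N j + meshSize N from node_succ N j]
        field_simp
        ring
    _ ≤ _ := h1
    _ = _ := by ring

/-- The trapezoidal sum approximates `U 1 - U 0 = 0` to order `h²`, and the end corrections are
`h/6` times increments of `U₁` of size `K * h`. -/
theorem sq_nodalQuad_le (h : IsRegular U U₁ U₂ Γ) (hN : 2 ≤ N) (h0 : U 0 = 0) (h1 : U 1 = 0)
    {K : ℝ} (hK : ∀ x ∈ Icc (0 : ℝ) 1, |U₂ x| ≤ K) :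
    nodalQuad N (fun i => U₁ (node N i)) ^ 2
      ≤ (8 * (Γ 1 - Γ 0) + K ^ 2) * meshSize N ^ 4 := by
  have hpos := meshSize_pos hN
  have hmul := natCast_mul_meshSize hN
  set m := meshSize N with hm
  set T := m * ∑ j ∈ Finset.range N, (U₁ (node N j) + U₁ (node N (j + 1))) / 2 with hT
  set S := ∑ j ∈ Finset.range N, osc N Γ j with hS
  have hTS : |T| ≤ 2 * m ^ 2 * S := by
    have e : -T = ∑ j ∈ Finset.range N, (U (node N (j + 1)) - U (node N j)
        - m * ((U₁ (node N j) + U₁ (node N (j + 1))) / 2)) := by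
      rw [Finset.sum_sub_distrib, Finset.sum_range_sub (fun j => U (node N j)), node_self hN,
        node_zero, h0, h1, ← Finset.mul_sum, hT]
      ring
    rw [← abs_neg, e, hS, Finset.mul_sum]
    exact (Finset.abs_sum_le_sum_abs _ _).trans
      (Finset.sum_le_sum fun j hj => h.abs_trapezoid_le hN (Finset.mem_range.1 hj))
  have hS2 : S ^ 2 ≤ Γ 1 - Γ 0 := by
    have a1 : S ^ 2 ≤ N * ∑ j ∈ Finset.range N, osc N Γ j ^ 2 := by
      simpa using sq_sum_le_card_mul_sum_sq (s := Finset.range N) (f := osc N Γ)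
    rw [h.sum_sq_osc hN] at a1
    calc S ^ 2 ≤ _ := a1
      _ = _ := by linear_combination (Γ 1 - Γ 0) * hmul
  have hT2 : T ^ 2 ≤ 4 * (Γ 1 - Γ 0) * m ^ 4 := by
    calc T ^ 2 = |T| ^ 2 := (sq_abs _).symm
      _ ≤ (2 * m ^ 2 * S) ^ 2 := by gcongr
      _ = 4 * m ^ 4 * S ^ 2 := by ring
      _ ≤ 4 * m ^ 4 * (Γ 1 - Γ 0) := by gcongr
      _ = _ := by ring
  have hincr : ∀ j < N, |U₁ (node N (j + 1)) - U₁ (node N j)| ≤ K * m := by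
    intro j hj
    have a1 := abs_sub_le_of_hasDerivAt h.hasDerivAt_deriv hK
      (x := node N j) (y := node N (j + 1))
      ⟨node_nonneg hN j, node_le_one hN hj.le⟩ ⟨node_nonneg hN _, node_le_one hN hj⟩
    rwa [node_succ, add_sub_cancel_left, abs_of_pos hpos, ← node_succ] at a1
  have b1 := hincr 0 (by omega)
  have b2 := hincr (N - 1) (by omega)
  rw [Nat.sub_add_cancel (by omega : 1 ≤ N)] at b2
  simp only [zero_add] at b1
  have hend : |m / 6 * (U₁ (node N 1) - U₁ (node N 0) + U₁ (node N (N - 1)) - U₁ (node N N))|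
      ≤ m ^ 2 / 3 * K := by
    rw [abs_mul, abs_of_pos (by positivity : 0 < m / 6)]
    have : |U₁ (node N 1) - U₁ (node N 0) + U₁ (node N (N - 1)) - U₁ (node N N)| ≤ 2 * (K * m) := by
      rw [abs_le] at *
      constructor <;> linarith [b1.1, b1.2, b2.1, b2.2]
    calc _ ≤ m / 6 * (2 * (K * m)) := by gcongr
      _ = _ := by ring
  have hend2 := sq_le_sq' (neg_le_of_abs_le hend) (le_of_abs_le hend)
  rw [nodalQuad, ← hm, ← hT]
  set Z := m / 6 * (U₁ (node N 1) - U₁ (node N 0) + U₁ (node N (N - 1)) - U₁ (node N N)) with hZ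
  have : (m ^ 2 / 3 * K) ^ 2 = K ^ 2 * m ^ 4 / 9 := by ring
  nlinarith [sq_nonneg (T - Z), mul_nonneg (sq_nonneg K) (by positivity : 0 ≤ m ^ 4)]

end IsRegular

/-! ### The error estimate -/

/-- The local error bound on the `k`-th cell, for nodal derivatives `d` and oscillations `o`. -/
noncomputable def localError (N : ℕ) (o d D : ℕ → ℝ) (k : ℕ) : ℝ :=
  Real.sqrt (8 * (o k * meshSize N) ^ 2 + 2 * (d k - D k) ^ 2 + 2 * (d (k + 1) - D (k + 1)) ^ 2
    + (if k = 0 then 0 else 1 / 6 * (d (k - 1) - 2 * d k + d (k + 1))) ^ 2)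

theorem sq_localError (N : ℕ) (o d D : ℕ → ℝ) (k : ℕ) :
    localError N o d D k ^ 2 = 8 * (o k * meshSize N) ^ 2 + 2 * (d k - D k) ^ 2
      + 2 * (d (k + 1) - D (k + 1)) ^ 2
      + (if k = 0 then 0 else 1 / 6 * (d (k - 1) - 2 * d k + d (k + 1))) ^ 2 :=
  Real.sq_sqrt (by positivity)

theorem sum_sq_localError_le {N : ℕ} (hN : 2 ≤ N) (o d D : ℕ → ℝ) :
    ∑ k ∈ Finset.range N, localError N o d D k ^ 2
      ≤ 8 * meshSize N ^ 2 * ∑ k ∈ Finset.range N, o k ^ 2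
        + 5 * ∑ i ∈ Finset.range (N + 1), (d i - D i) ^ 2
        + ∑ k ∈ Finset.range (N - 1), (D k - 2 * D (k + 1) + D (k + 2)) ^ 2 := by
  obtain ⟨n, rfl⟩ : ∃ n, N = n + 1 := ⟨N - 1, by omega⟩
  simp only [sq_localError, Finset.sum_add_distrib, Nat.add_sub_cancel, mul_pow]
  rw [← Finset.mul_sum, ← Finset.mul_sum, ← Finset.mul_sum, ← Finset.sum_mul,
    Finset.sum_range_succ' (fun k => (if k = 0 then (0 : ℝ) else
      1 / 6 * (d (k - 1) - 2 * d k + d (k + 1))) ^ 2)]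
  simp only [Nat.add_eq_zero_iff, one_ne_zero, and_false, if_false, if_true, Nat.add_sub_cancel]
  set E := ∑ i ∈ Finset.range (n + 1 + 1), (d i - D i) ^ 2 with hE
  have h1 : ∑ k ∈ Finset.range (n + 1), (d k - D k) ^ 2 ≤ E :=
    Finset.sum_le_sum_of_subset_of_nonneg (Finset.range_mono (by omega)) fun _ _ _ => sq_nonneg _
  have h2 : ∑ k ∈ Finset.range (n + 1), (d (k + 1) - D (k + 1)) ^ 2 ≤ E := by
    rw [hE, Finset.sum_range_succ' _ (n + 1)]
    linarith [sq_nonneg (d 0 - D 0)]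
  have h0 : ∑ k ∈ Finset.range n, (d k - D k) ^ 2 ≤ E :=
    Finset.sum_le_sum_of_subset_of_nonneg (Finset.range_mono (by omega)) fun _ _ _ => sq_nonneg _
  have h3 : ∑ k ∈ Finset.range n, (d (k + 1) - D (k + 1)) ^ 2 ≤ E :=
    (Finset.sum_le_sum_of_subset_of_nonneg (Finset.range_mono (by omega))
      fun _ _ _ => sq_nonneg _).trans h2
  have h4 : ∑ k ∈ Finset.range n, (d (k + 2) - D (k + 2)) ^ 2 ≤ E := by
    refine le_trans ?_ h2
    rw [Finset.sum_range_succ' _ n]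
    linarith [sq_nonneg (d (0 + 1) - D (0 + 1))]
  have h5 : ∑ k ∈ Finset.range n, (1 / 6 * (d k - 2 * d (k + 1) + d (k + 1 + 1))) ^ 2
      ≤ ∑ k ∈ Finset.range n, (1 / 3 * ((d k - D k) ^ 2 + (d (k + 1) - D (k + 1)) ^ 2
        + (d (k + 2) - D (k + 2)) ^ 2) + (D k - 2 * D (k + 1) + D (k + 2)) ^ 2) := by
    refine Finset.sum_le_sum fun k _ => ?_
    -- The weights `1, -2, 1` have squared length `6`, so `(x - 2y + z)² ≤ 6 (x² + y² + z²)`;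
    -- doubling and dividing by `36` leaves `1/3`. The three shifted sums then add `1` to the `2 +
    -- 2` from the gradient terms, giving `5`.
    have key : ∀ x y z s : ℝ, (1 / 6 * (x - 2 * y + z + s)) ^ 2
        ≤ 1 / 3 * (x ^ 2 + y ^ 2 + z ^ 2) + s ^ 2 := fun x y z s => by
      nlinarith [sq_nonneg (x - 2 * y + z - s), sq_nonneg (x - z), sq_nonneg (2 * x + y),
        sq_nonneg (2 * z + y), sq_nonneg s]
    have := key (d k - D k) (d (k + 1) - D (k + 1)) (d (k + 2) - D (k + 2))
      (D k - 2 * D (k + 1) + D (k + 2))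
    convert! this using 1
    ring
  rw [Finset.sum_add_distrib, ← Finset.mul_sum, Finset.sum_add_distrib,
    Finset.sum_add_distrib] at h5
  linarith

/-- The gradient error is the interpolation error of `U₁` minus a convex combination of the two
nodal errors. Since `u` is continuous and vanishes at the boundary, the jumps come from the
reconstruction alone. -/
theorem isControlled_error {u U U₁ U₂ Γ : ℝ → ℝ} (h : IsRegular U U₁ U₂ Γ)
    (hu : ∀ x ∈ Icc (0 : ℝ) 1, u x = U x) (h0 : U 0 = 0) (h1 : U 1 = 0) {N : ℕ} (hN : 2 ≤ N)
    {a d : ℕ → ℝ} (hst : IsStencil N a d) :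
    IsControlled (restrictCells N u - toBroken fun j : Fin N => recPoly N a d j)
      (localError N (IsRegular.osc N Γ) d fun i => U₁ (node N i)) := by
  have hpos := meshSize_pos hN
  set p : Fin N → ℝ[X] := fun j => recPoly N a d j with hp
  set w := restrictCells N u - toBroken p with hw
  have hcell : ∀ j : Fin N, cell N j ⊆ Icc 0 1 := fun j =>
    Icc_subset_Icc (node_nonneg hN j) (node_le_one hN j.isLt)
  have hd : ∀ j, ∀ x ∈ cell N j,
      HasDerivWithinAt (w j) (U₁ x - (derivative (p j)).eval x) (cell N j) x := by
    intro j x hx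
    refine HasDerivWithinAt.congr_of_mem
      ((h.hasDerivAt x).sub ((p j).hasDerivAt x)).hasDerivWithinAt ?_ hx
    intro y hy
    simp [hw, restrictCells, toBroken, hu y (hcell j hy)]
  have hu0 : u 0 = 0 := by rw [hu 0 (by simp), h0]
  have hu1 : u 1 = 0 := by rw [hu 1 (by simp), h1]
  have htr : ∀ i, leftTrace w i - rightTrace w i
      = -(leftTrace (toBroken p) i - rightTrace (toBroken p) i) := by
    rintro ⟨i, hi⟩
    simp only [leftTrace, rightTrace, hw, Pi.sub_apply, restrictCells]
    split_ifs with a1 a2 a2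
    · ring
    · obtain rfl : i = N := by omega
      rw [node_self hN, hu1]
      ring
    · obtain rfl : i = 0 := by omega
      rw [node_zero, hu0]
      ring
    · ring
  refine ⟨fun j x hx => (hd j x hx).differentiableWithinAt, ?_, ?_, ?_⟩
  · intro j x hx
    have e : grad w j x = U₁ x - (derivative (p j)).eval x :=
      (hd j x hx).derivWithin (uniqueDiffOn_Icc (node_lt_succ hN j) x hx)
    rw [e, hp]
    refine Real.abs_le_sqrt ?_
    simp only [eval_derivative_recPoly]
    have hI := h.abs_sub_interp_le hN j.isLt hx
    set θ := (x - node N j) / meshSize N with hθ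
    have hθ0 : 0 ≤ θ := div_nonneg (sub_nonneg.2 hx.1) hpos.le
    have hθ1 : θ ≤ 1 := (div_le_one hpos).2 (by
      have := hx.2
      rw [node_succ] at this
      linarith)
    have hI2 := sq_le_sq' (neg_le_of_abs_le hI) (le_of_abs_le hI)
    set A := U₁ x - (U₁ (node N j) + θ * (U₁ (node N (j + 1)) - U₁ (node N j))) with hA
    set e0 := d j - U₁ (node N j) with he0
    set e1 := d (j + 1) - U₁ (node N (j + 1)) with he1
    have e2 : U₁ x - (d j + θ * (d (j + 1) - d j)) = A - ((1 - θ) * e0 + θ * e1) := by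
      rw [hA, he0, he1]
      ring
    have hconv : ((1 - θ) * e0 + θ * e1) ^ 2 ≤ e0 ^ 2 + e1 ^ 2 := by
      have b1 : ((1 - θ) * e0 + θ * e1) ^ 2
          = (1 - θ) * e0 ^ 2 + θ * e1 ^ 2 - θ * (1 - θ) * (e0 - e1) ^ 2 := by ring
      have b2 := mul_nonneg (mul_nonneg hθ0 (sub_nonneg.2 hθ1)) (sq_nonneg (e0 - e1))
      have b3 := mul_nonneg hθ0 (sq_nonneg e0)
      have b4 := mul_nonneg (sub_nonneg.2 hθ1) (sq_nonneg e1)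
      linarith
    rw [e2]
    nlinarith [sq_nonneg (A + ((1 - θ) * e0 + θ * e1)),
      sq_nonneg (if j.val = 0 then 0 else 1 / 6 * (d (j.val - 1) - 2 * d j + d (j + 1)))]
  · intro i
    rw [htr, abs_neg, hp, leftTrace_sub_rightTrace_recPoly hN hst]
    have e : (if (i.castSucc : Fin (N + 1)).val = 0 ∨ (i.castSucc : Fin (N + 1)).val = N then 0
        else meshSize N / 6 * (d ((i.castSucc : Fin (N + 1)).val - 1)
          - 2 * d (i.castSucc : Fin (N + 1)).val + d ((i.castSucc : Fin (N + 1)).val + 1)))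
        = meshSize N *
          (if i.val = 0 then 0 else 1 / 6 * (d (i.val - 1) - 2 * d i + d (i + 1))) := by
      simp only [Fin.val_castSucc, i.isLt.ne, or_false]
      split_ifs <;> ring
    rw [e, abs_mul, abs_of_pos hpos]
    refine mul_le_mul_of_nonneg_left (Real.abs_le_sqrt ?_) hpos.le
    have := sq_nonneg (IsRegular.osc N Γ i * meshSize N)
    have := sq_nonneg (d i - U₁ (node N i))
    have := sq_nonneg (d (i + 1) - U₁ (node N (i + 1)))
    linarith
  · have := htr (Fin.last N)
    rw [hp, leftTrace_sub_rightTrace_recPoly hN hst, if_pos (Or.inr (by simp)),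
      rightTrace_last] at this
    linarith

/-- Stability applied to the nodal values of `U₁`: the factor `N` in front of the `O(h⁴)` squared
quadrature residual brings it to `h³`, the order of the second differences. -/
theorem sum_sq_error_le {η c K : ℝ} (hc : 0 < c) (hc1 : c ≤ 1) (hcη : c ≤ 1 + 2 * η / 3)
    {U U₁ U₂ Γ : ℝ → ℝ} (h : IsRegular U U₁ U₂ Γ) (h0 : U 0 = 0) (h1 : U 1 = 0)
    (hK : ∀ x ∈ Icc (0 : ℝ) 1, |U₂ x| ≤ K) {N : ℕ} (hN : 2 ≤ N) {d : ℕ → ℝ}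
    (hd : nodalQuad N d = 0) (hfl : ∀ j < N, flux η N d (j + 1) - flux η N d j
      = U₁ (node N j) - U₁ (node N (j + 1))) :
    ∑ i ∈ Finset.range (N + 1), (d i - U₁ (node N i)) ^ 2
      ≤ (2 * η ^ 2 / c ^ 2 * (Γ 1 - Γ 0) + 8 * (8 * (Γ 1 - Γ 0) + K ^ 2)) * meshSize N ^ 3 := by
  have hpos := meshSize_pos hN
  have hmul := natCast_mul_meshSize hN
  have key := sum_sq_sub_le_of_flux hc hc1 hcη hN (D := fun i => U₁ (node N i)) hd hfl
  have e1 := h.sum_sq_second_diff_le hN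
  have e2 := h.sq_nodalQuad_le hN h0 h1 hK
  simp only [mul_pow] at key
  rw [← Finset.mul_sum] at key
  calc _ ≤ _ := key
    _ ≤ 18 / c ^ 2 * ((η / 6) ^ 2 * (4 * meshSize N ^ 3 * (Γ 1 - Γ 0)))
        + 8 * N * ((8 * (Γ 1 - Γ 0) + K ^ 2) * meshSize N ^ 4) := by gcongr
    _ = _ := by
      linear_combination 8 * (8 * (Γ 1 - Γ 0) + K ^ 2) * meshSize N ^ 3 * hmul

end RDG

theorem mainTheorem1 (η : ℝ) (hη : -(3 / 2) < η) (hη' : η < 5)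
    (f u : ℝ → ℝ) (hf : RDG.MemL2 f)
    (hsol : RDG.IsPoissonSolution f u) (hu : RDG.MemSobolev 3 u) :
    ∃ h₀ : ℝ, 0 < h₀ ∧ ∃ C : ℝ, 0 < C ∧
      ∀ N : ℕ, 2 ≤ N → RDG.meshSize N < h₀ →
        (∃! uh : Fin N → Polynomial ℝ, RDG.IsDiscreteSolution η f N uh) ∧
        ∀ uh : Fin N → Polynomial ℝ, RDG.IsDiscreteSolution η f N uh →
          RDG.sipStarNorm (RDG.restrictCells N u - RDG.toBroken uh) ≤ C * RDG.meshSize N ^ 2 ∧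
          RDG.l2Norm (RDG.restrictCells N u - RDG.toBroken uh) ≤ C * RDG.meshSize N ^ 2 := by
  obtain ⟨U, U₁, U₂, Γ, huU, hU, hU₁, hU₂, hΓ, hmono, hfU, h0, h1⟩ :=
    RDG.exists_regular_representative hf hsol hu
  have hreg : RDG.IsRegular U U₁ U₂ Γ := ⟨hU, hU₁, hΓ, hmono⟩
  obtain ⟨K, hK⟩ := isCompact_Icc.exists_bound_of_continuousOn (s := Icc (0 : ℝ) 1)
    hU₂.continuousOn
  set c : ℝ := min 1 (1 + 2 * η / 3) with hc
  have hc0 : 0 < c := lt_min one_pos (by linarith)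
  set G := Γ 1 - Γ 0 with hG
  have hG0 : 0 ≤ G := sub_nonneg.2 (hmono 0 1 le_rfl zero_le_one le_rfl)
  set C₁ := 2 * η ^ 2 / c ^ 2 * G + 8 * (8 * G + K ^ 2) with hC₁
  -- In `12 * G`, `8` comes from the oscillations and `4` from the second differences; `5 * C₁`
  -- comes from the nodal errors. The added `1` makes `C` positive.
  refine ⟨1, one_pos, Real.sqrt (4 * (12 * G + 5 * C₁)) + 1, by positivity, fun N hN _ =>
    ⟨RDG.existsUnique_isDiscreteSolution hη f hN, fun uh huh => ?_⟩⟩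
  have hpos := RDG.meshSize_pos hN
  obtain ⟨a, d, hst, hp, hfl⟩ := (RDG.isDiscreteSolution_iff hN).1 huh
  obtain rfl : uh = fun j : Fin N => RDG.recPoly N a d j := funext hp
  have hE := RDG.sum_sq_error_le hc0 (min_le_left _ _) (min_le_right _ _) hreg h0 h1 hK hN
    (hst.nodalQuad_eq_zero hN) fun j hj => (hfl j hj).trans
      (hfU _ _ (RDG.node_nonneg hN j) (RDG.node_lt_succ hN j).le (RDG.node_le_one hN hj))
  have hctl := RDG.isControlled_error hreg huU h0 h1 hN hst
  have hr : ∑ k ∈ Finset.range N, RDG.localError N (RDG.IsRegular.osc N Γ) d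
      (fun i => U₁ (RDG.node N i)) k ^ 2 ≤ (12 * G + 5 * C₁) * RDG.meshSize N ^ 3 := by
    refine (RDG.sum_sq_localError_le hN _ _ _).trans ?_
    rw [hreg.sum_sq_osc hN]
    linarith [hreg.sum_sq_second_diff_le hN]
  have hfin : Real.sqrt (4 * RDG.meshSize N * ∑ k ∈ Finset.range N,
      RDG.localError N (RDG.IsRegular.osc N Γ) d (fun i => U₁ (RDG.node N i)) k ^ 2)
      ≤ (Real.sqrt (4 * (12 * G + 5 * C₁)) + 1) * RDG.meshSize N ^ 2 := by
    calc _ ≤ Real.sqrt (4 * (12 * G + 5 * C₁) * (RDG.meshSize N ^ 2) ^ 2) := by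
          refine Real.sqrt_le_sqrt ?_
          calc _ ≤ 4 * RDG.meshSize N * ((12 * G + 5 * C₁) * RDG.meshSize N ^ 3) := by gcongr
            _ = _ := by ring
      _ = Real.sqrt (4 * (12 * G + 5 * C₁)) * RDG.meshSize N ^ 2 := by
          rw [Real.sqrt_mul' _ (sq_nonneg _), Real.sqrt_sq (sq_nonneg _)]
      _ ≤ _ := by
          rw [add_mul]
          linarith [sq_nonneg (RDG.meshSize N)]
  exact ⟨(hctl.sipStarNorm_le hN).trans hfin, (hctl.l2Norm_le hN).trans hfin⟩
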